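/- Let $K\in\mathbb N$ be fixed and let $p=p(n)$ satisfy $p/n\to c\in(0,\infty)$ as $n\to\infty$. For each $n$ and $r\in\{1,\dots,K\}$ let $A_n^{(r)}\in\mathbb C^{p\times p}$ and $B_n^{(r)}\in\mathbb C^{n\times n}$ be non-random positive semidefinite matrices such that, for some $\tau>0$, $\|A_n^{(r)}\|_{op}\le\tau$ and $\|B_n^{(r)}\|_{op}\le\tau$ for all $n$ and $r$. For $\mathbf Z=(Z^{(1)},\dots,Z^{(K)})$ with $Z^{(r)}\in\mathbb C^{p\times n}$, put $$X_n(\mathbf Z)=\sum_{r=1}^K (A_n^{(r)})^{1/2}Z^{(r)}(B_n^{(r)})^{1/2},\qquad \mathcal S_n(\mathbf Z)=\frac1n X_n(\mathbf Z)X_n(\mathbf Z)^*,$$ and for $z\in\mathbb C_+=\{z:\Im z>0\}$ let $f_n(\mathbf Z;z)=\frac1p\operatorname{trace}\big((\mathcal S_n(\mathbf Z)-zI_p)^{-1}\big)$, the Stieltjes transform of the empirical spectral distribution of $\mathcal S_n(\mathbf Z)$. For each $n$, let $\mathbf Z_n=(Z_n^{(1)},\dots,Z_n^{(K)})$ be random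 complex $p\times n$ matrices, all of whose entries $z_{ij}^{(r)}$ are independent with $\mathbb E z_{ij}^{(r)}=0$ and $\mathbb E|z_{ij}^{(r)}|^2=1$, and let $\mathbf W_n=(W_n^{(1)},\dots,W_n^{(K)})$ be random complex $p\times n$ matrices whose entries are i.i.d. standard complex Gaussian (independent real and imaginary parts, each $N(0,1/2)$). Let $\eta_0>0$ and $\frac1{4+\eta_0}<a<\frac14$. Write $\hat{\mathbf Z}_n$ and $\hat{\mathbf W}_n$ for the matrices obtained by replacing every entry of modulus larger than $n^a$ by $0$. Then for every $z\in\mathbb C_+$ the following hold. 1. If $\sup_{n,r,i,j}\mathbb E|z_{ij}^{(r)}|^{4+\eta_0}<\infty$, then, as $n\to\infty$, $$\big|\mathbb E f_n(\hat{\mathbf W}_n;z)-\mathbb E f_n(\hat{\mathbf Z}_n;z)\big|\to0\quad\text{and}\quad \big|\mathbb E f_n(\mathbf W_n;z)-\mathbb E f_n(\hat{\mathbf Z}_n;z)\big|\to0 .$$ 2. If $|z_{ij}^{(r)}|\le n^a$ almost surely for all $n,r,i,j$, then, as $n\to\infty$, $$\big|\mathbb E f_n(\hat{\mathbf W}_n;z)-\mathbb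 E f_n(\mathbf Z_n;z)\big|\to0\quad\text{and}\quad \big|\mathbb E f_n(\mathbf W_n;z)-\mathbb E f_n(\mathbf Z_n;z)\big|\to0 .$$ -/

import Mathlib

open MeasureTheory ProbabilityTheory Filter Topology
open scoped MatrixOrder ComplexOrder

noncomputable section

/-- Spectral (operator) norm of a square complex matrix, acting on Euclidean space. -/
def opNorm {m : ℕ} (A : Matrix (Fin m) (Fin m) ℂ) : ℝ :=
  ‖Matrix.toEuclideanCLM (n := Fin m) (𝕜 := ℂ) A‖

/-- `X = ∑ r, (A r)^{1/2} Z r (B r)^{1/2}`, with positive semidefinite square roots. -/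
def dataMatrix {K p n : ℕ} (A : Fin K → Matrix (Fin p) (Fin p) ℂ)
    (B : Fin K → Matrix (Fin n) (Fin n) ℂ) (Z : Fin K → Matrix (Fin p) (Fin n) ℂ) :
    Matrix (Fin p) (Fin n) ℂ :=
  ∑ r, CFC.sqrt (A r) * Z r * CFC.sqrt (B r)

/-- `(1 / n) X X*`, where `X` is the data matrix with innovations `Z`. -/
def sampleCov {K p n : ℕ} (A : Fin K → Matrix (Fin p) (Fin p) ℂ)
    (B : Fin K → Matrix (Fin n) (Fin n) ℂ) (Z : Fin K → Matrix (Fin p) (Fin n) ℂ) :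
    Matrix (Fin p) (Fin p) ℂ :=
  (1 / (n : ℂ)) • (dataMatrix A B Z * (dataMatrix A B Z).conjTranspose)

/-- The Stieltjes transform at `z` of the empirical spectral distribution of a Hermitian
matrix `S`, given as the normalized trace of the resolvent `(S - z I)⁻¹`. -/
def stieltjes {p : ℕ} (S : Matrix (Fin p) (Fin p) ℂ) (z : ℂ) : ℂ :=
  (1 / (p : ℂ)) * ((S - z • (1 : Matrix (Fin p) (Fin p) ℂ))⁻¹).trace

/-- For Hermitian `S`, `stieltjes S z` is the integral of `1 / (x - z)` against the uniform
distribution on the eigenvalues of `S`. -/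
theorem stieltjes_eq_sum {p : ℕ} {S : Matrix (Fin p) (Fin p) ℂ} (hS : S.IsHermitian)
    {z : ℂ} (hz : 0 < z.im) :
    stieltjes S z = (1 / (p : ℂ)) * ∑ i, 1 / ((hS.eigenvalues i : ℂ) - z) := by
  have hne : ∀ i, ((hS.eigenvalues i : ℂ) - z) ≠ 0 := by
    intro i h
    have := congrArg Complex.im h
    simp at this
    exact hz.ne' this
  set U := hS.eigenvectorUnitary with hU
  set φ := Unitary.conjStarAlgAut ℂ (Matrix (Fin p) (Fin p) ℂ) U with hφ
  have h1 : S - z • (1 : Matrix (Fin p) (Fin p) ℂ) =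
      φ (Matrix.diagonal fun i => (hS.eigenvalues i : ℂ) - z) := by
    have e : (Matrix.diagonal fun i => (hS.eigenvalues i : ℂ) - z) =
        Matrix.diagonal (RCLike.ofReal ∘ hS.eigenvalues) - z • (1 : Matrix (Fin p) (Fin p) ℂ) := by
      rw [← Matrix.diagonal_one, ← Matrix.diagonal_smul, Matrix.diagonal_sub]
      congr 1
      funext i
      simp
    rw [e, map_sub, map_smul, map_one, hφ, ← hS.spectral_theorem]
  have h2 : (S - z • (1 : Matrix (Fin p) (Fin p) ℂ))⁻¹ =
      φ (Matrix.diagonal fun i => 1 / ((hS.eigenvalues i : ℂ) - z)) := by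
    apply Matrix.inv_eq_right_inv
    rw [h1, ← map_mul, Matrix.diagonal_mul_diagonal]
    simp [hne]
  have h3 : ∀ D : Matrix (Fin p) (Fin p) ℂ, (φ D).trace = D.trace := by
    intro D
    rw [hφ, Unitary.conjStarAlgAut_apply, Matrix.trace_mul_cycle, Unitary.coe_star_mul_self,
      one_mul]
  rw [stieltjes, h2, h3, Matrix.trace_diagonal]

/-- Entrywise truncation: entries of modulus greater than `b` are replaced by `0`. -/
def truncate {p n : ℕ} (b : ℝ) (Z : Matrix (Fin p) (Fin n) ℂ) : Matrix (Fin p) (Fin n) ℂ :=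
  Z.map fun w => if ‖w‖ ≤ b then w else 0

/-- The standard (circularly symmetric) complex Gaussian law: independent real and imaginary
parts, each distributed as `N(0, 1/2)`. -/
def stdComplexGaussian : Measure ℂ :=
  ((gaussianReal 0 (1 / 2)).prod (gaussianReal 0 (1 / 2))).map
    fun x : ℝ × ℝ => (x.1 : ℂ) + (x.2 : ℂ) * Complex.I

end

/-!
Choose `w` with `w² = z`. Up to a deterministic term, the Stieltjes transform of `(1 / n) X X*` at
`z` is a multiple of the trace of the resolvent at `w` of the Hermitization of `X / √n`, a Hermitian
matrix depending real-linearly on the innovations. One innovation after another is exchanged by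
Lindeberg's method. Truncated laws match the standard Gaussian law in `h`, `h̄` and `|h|²` up to
small errors, but nothing is assumed on the moments of `h²` and `h̄²`, whose coefficients are too
large to be bounded one by one. Summed over all innovations not yet exchanged these coefficients are
under control, so some innovation has a coefficient at most the average; exchanging that one at
every stage costs a harmonic sum, hence only a logarithm.
-/

open scoped ComplexConjugate

section NearStandardLaws

/-- A complex law which is standard (mean `0`, second absolute moment `1`) up to errors `ε₁` in the
mean and `ε₂` in the second absolute moment, with third absolute moment at most `L`. -/
structure IsNearStandard (μ : Measure ℂ) (ε₁ ε₂ L : ℝ) : Prop where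
  memLp : MemLp id 3 μ
  norm_mean_le : ‖∫ h, h ∂μ‖ ≤ ε₁
  abs_secondMoment_sub_one_le : |∫ h, ‖h‖ ^ 2 ∂μ - 1| ≤ ε₂
  thirdMoment_le : ∫ h, ‖h‖ ^ 3 ∂μ ≤ L

namespace IsNearStandard

variable {μ : Measure ℂ} {ε₁ ε₂ L : ℝ}

theorem mono {ε₁' ε₂' L' : ℝ} (hμ : IsNearStandard μ ε₁ ε₂ L) (h₁ : ε₁ ≤ ε₁') (h₂ : ε₂ ≤ ε₂')
    (h₃ : L ≤ L') : IsNearStandard μ ε₁' ε₂' L' :=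
  ⟨hμ.memLp, hμ.norm_mean_le.trans h₁, hμ.abs_secondMoment_sub_one_le.trans h₂,
    hμ.thirdMoment_le.trans h₃⟩

theorem nonneg_mean_error (hμ : IsNearStandard μ ε₁ ε₂ L) : 0 ≤ ε₁ :=
  (norm_nonneg _).trans hμ.norm_mean_le

theorem nonneg_secondMoment_error (hμ : IsNearStandard μ ε₁ ε₂ L) : 0 ≤ ε₂ :=
  (abs_nonneg _).trans hμ.abs_secondMoment_sub_one_le

theorem integrable_norm_pow_three (hμ : IsNearStandard μ ε₁ ε₂ L) :
    Integrable (fun h : ℂ => ‖h‖ ^ 3) μ :=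
  hμ.memLp.integrable_norm_pow three_ne_zero

theorem secondMoment_le (hμ : IsNearStandard μ ε₁ ε₂ L) : ∫ h, ‖h‖ ^ 2 ∂μ ≤ 1 + ε₂ := by
  linarith [(abs_le.1 hμ.abs_secondMoment_sub_one_le).2]

variable [IsProbabilityMeasure μ]

theorem integrable_id (hμ : IsNearStandard μ ε₁ ε₂ L) : Integrable (fun h : ℂ => h) μ :=
  hμ.memLp.integrable (by norm_num)

theorem integrable_norm_sq (hμ : IsNearStandard μ ε₁ ε₂ L) :
    Integrable (fun h : ℂ => ‖h‖ ^ 2) μ :=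
  (hμ.memLp.mono_exponent (p := 2) (by norm_num)).integrable_norm_pow two_ne_zero

theorem firstMoment_le (hμ : IsNearStandard μ ε₁ ε₂ L) : ∫ h, ‖h‖ ∂μ ≤ 1 + ε₂ := by
  have hle : ∫ h, ‖h‖ ∂μ ≤ ∫ h, (1 + ‖h‖ ^ 2) / 2 ∂μ :=
    integral_mono hμ.integrable_id.norm
      (((integrable_const 1).add hμ.integrable_norm_sq).div_const 2)
      fun h => by linarith [sq_nonneg (‖h‖ - 1)]
  rw [integral_div, integral_add (integrable_const 1) hμ.integrable_norm_sq, integral_const,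
    probReal_univ, one_smul] at hle
  linarith [hμ.secondMoment_le, hμ.nonneg_secondMoment_error]

end IsNearStandard

end NearStandardLaws

section QuadraticApproximation

/-- A real polynomial map of degree at most `2` from `ℂ` to `E`, written in `h` and `conj h`. -/
structure QuadPoly (E : Type*) where
  const : E
  lin : E
  linConj : E
  sq : E
  sqConj : E
  normSq : E

variable {E : Type*} [NormedAddCommGroup E] [NormedSpace ℂ E]

namespace QuadPoly

/-- The value of a polynomial map of degree at most `2`. -/
noncomputable def eval (f : QuadPoly E) (h : ℂ) : E :=
  f.const + h • f.lin + conj h • f.linConj + h ^ 2 • f.sq + conj h ^ 2 • f.sqConj +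
    ((‖h‖ ^ 2 : ℝ) : ℂ) • f.normSq

variable {μ : Measure ℂ} [IsProbabilityMeasure μ] {ε₁ ε₂ L : ℝ}

theorem integrable_eval_and_integral_eval_eq [CompleteSpace E] (hμ : IsNearStandard μ ε₁ ε₂ L)
    (f : QuadPoly E) :
    Integrable f.eval μ ∧ ∫ h, f.eval h ∂μ =
      f.const + (∫ h, h ∂μ) • f.lin + conj (∫ h, h ∂μ) • f.linConj + (∫ h, h ^ 2 ∂μ) • f.sq +
        conj (∫ h, h ^ 2 ∂μ) • f.sqConj + ((∫ h, ‖h‖ ^ 2 ∂μ : ℝ) : ℂ) • f.normSq := by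
  have hsq := hμ.integrable_norm_sq
  have := integrable_const (μ := μ) f.const
  have i₁ : Integrable (fun h : ℂ => h • f.lin) μ := hμ.integrable_id.smul_const _
  have i₂ : Integrable (fun h : ℂ => conj h • f.linConj) μ :=
    ((integrable_norm_iff (by fun_prop)).1 (by simpa using hμ.integrable_id.norm)).smul_const _
  have i₃ : Integrable (fun h : ℂ => h ^ 2 • f.sq) μ :=
    ((integrable_norm_iff (by fun_prop)).1 (by simpa using hsq)).smul_const _
  have i₄ : Integrable (fun h : ℂ => conj h ^ 2 • f.sqConj) μ :=
    ((integrable_norm_iff (by fun_prop)).1 (by simpa using hsq)).smul_const _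
  have i₅ : Integrable (fun h : ℂ => ((‖h‖ ^ 2 : ℝ) : ℂ) • f.normSq) μ := hsq.ofReal.smul_const _
  unfold eval
  refine ⟨by fun_prop, ?_⟩
  rw [integral_add (by fun_prop) (by fun_prop), integral_add (by fun_prop) (by fun_prop),
    integral_add (by fun_prop) (by fun_prop), integral_add (by fun_prop) (by fun_prop),
    integral_add (by fun_prop) (by fun_prop)]
  simp only [integral_smul_const, integral_complex_ofReal, ← integral_conj, map_pow,
    integral_const, probReal_univ, one_smul]

theorem norm_integral_eval_sub_le [CompleteSpace E] (hμ : IsNearStandard μ ε₁ ε₂ L)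
    (f : QuadPoly E) :
    ‖∫ h, f.eval h ∂μ - (f.const + f.normSq)‖ ≤
      ε₁ * (‖f.lin‖ + ‖f.linConj‖) + (1 + ε₂) * (‖f.sq‖ + ‖f.sqConj‖) + ε₂ * ‖f.normSq‖ := by
  have hsq : ‖∫ h, h ^ 2 ∂μ‖ ≤ 1 + ε₂ :=
    (norm_integral_le_integral_norm _).trans (by simpa only [norm_pow] using hμ.secondMoment_le)
  have hnormSq : ‖((∫ h, ‖h‖ ^ 2 ∂μ : ℝ) : ℂ) - 1‖ ≤ ε₂ := by
    rw [← Complex.ofReal_one, ← Complex.ofReal_sub, Complex.norm_real]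
    exact hμ.abs_secondMoment_sub_one_le
  have hsub : ∫ h, f.eval h ∂μ - (f.const + f.normSq) =
      (∫ h, h ∂μ) • f.lin + conj (∫ h, h ∂μ) • f.linConj + (∫ h, h ^ 2 ∂μ) • f.sq +
        conj (∫ h, h ^ 2 ∂μ) • f.sqConj + (((∫ h, ‖h‖ ^ 2 ∂μ : ℝ) : ℂ) - 1) • f.normSq := by
    rw [(integrable_eval_and_integral_eval_eq hμ f).2]
    module
  have hsmul {a : ℂ} {b : ℝ} (v : E) (ha : ‖a‖ ≤ b) : ‖a • v‖ ≤ b * ‖v‖ :=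
    (norm_smul a v).trans_le (mul_le_mul_of_nonneg_right ha (norm_nonneg v))
  rw [hsub, mul_add, mul_add, ← add_assoc]
  exact norm_add_le_of_le (norm_add_le_of_le (norm_add_le_of_le (norm_add_le_of_le
    (hsmul _ hμ.norm_mean_le) (hsmul _ ((RCLike.norm_conj _).trans_le hμ.norm_mean_le)))
    (hsmul _ hsq)) (hsmul _ ((RCLike.norm_conj _).trans_le hsq))) (hsmul _ hnormSq)

end QuadPoly

/-- `f` is a second order expansion of `φ` at `0`. The coefficients `sq` and `sqConj`, whose terms
do not cancel when laws of equal variance are compared, are controlled by `g`. -/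
structure IsQuadApprox (φ : ℂ → E) (f : QuadPoly E) (g : ℂ → ℝ) (C₁ C₂ C₃ : ℝ) : Prop where
  linear_le : ‖f.lin‖ + ‖f.linConj‖ ≤ C₁
  mixed_le : ‖f.normSq‖ ≤ C₂
  pure_le : ∀ h, ‖f.sq‖ + ‖f.sqConj‖ ≤ g h + C₃ * ‖h‖
  remainder_le : ∀ h, ‖φ h - f.eval h‖ ≤ C₃ * ‖h‖ ^ 3

/-- The error made in exchanging two nearly standard laws of one variable in the expectation of a
function with a second order expansion, apart from the contribution of the coefficients `sq` and
`sqConj`. -/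
noncomputable def lindebergError (ε₁ ε₂ L C₁ C₂ C₃ : ℝ) : ℝ :=
  2 * (ε₁ * C₁ + ε₂ * C₂ + (1 + ε₂) ^ 2 * C₃ + C₃ * L)

namespace IsQuadApprox

variable {φ : ℂ → E} {f : QuadPoly E} {g : ℂ → ℝ} {μ ν : Measure ℂ} [IsProbabilityMeasure μ]
  [IsProbabilityMeasure ν] {ε₁ ε₂ L C₁ C₂ C₃ : ℝ}

theorem nonneg (hφ : IsQuadApprox φ f g C₁ C₂ C₃) : 0 ≤ C₃ := by
  simpa using (norm_nonneg _).trans (hφ.remainder_le 1)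

theorem norm_sq_add_le (hφ : IsQuadApprox φ f g C₁ C₂ C₃) (hν : IsNearStandard ν ε₁ ε₂ L)
    (hg : Integrable g ν) : ‖f.sq‖ + ‖f.sqConj‖ ≤ ∫ h, g h ∂ν + C₃ * (1 + ε₂) := by
  have hC := hν.integrable_id.norm.const_mul C₃
  calc ‖f.sq‖ + ‖f.sqConj‖ = ∫ _, ‖f.sq‖ + ‖f.sqConj‖ ∂ν := by simp
    _ ≤ ∫ h, g h + C₃ * ‖h‖ ∂ν := integral_mono (integrable_const _) (hg.add hC) hφ.pure_le
    _ = ∫ h, g h ∂ν + C₃ * ∫ h, ‖h‖ ∂ν := by rw [integral_add hg hC, integral_const_mul]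
    _ ≤ ∫ h, g h ∂ν + C₃ * (1 + ε₂) := by
      gcongr
      exacts [hφ.nonneg, hν.firstMoment_le]

variable [CompleteSpace E]

theorem norm_integral_sub_integral_eval_le (hφ : IsQuadApprox φ f g C₁ C₂ C₃)
    (hμ : IsNearStandard μ ε₁ ε₂ L) (hφμ : Integrable φ μ) :
    ‖∫ h, φ h ∂μ - ∫ h, f.eval h ∂μ‖ ≤ C₃ * L := by
  rw [← integral_sub hφμ (QuadPoly.integrable_eval_and_integral_eval_eq hμ f).1]
  calc ‖∫ h, φ h - f.eval h ∂μ‖ ≤ ∫ h, C₃ * ‖h‖ ^ 3 ∂μ :=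
        norm_integral_le_of_norm_le (hμ.integrable_norm_pow_three.const_mul C₃)
          (ae_of_all _ hφ.remainder_le)
    _ = C₃ * ∫ h, ‖h‖ ^ 3 ∂μ := integral_const_mul _ _
    _ ≤ C₃ * L := mul_le_mul_of_nonneg_left hμ.thirdMoment_le hφ.nonneg

theorem norm_integral_sub_integral_le (hφ : IsQuadApprox φ f g C₁ C₂ C₃)
    (hμ : IsNearStandard μ ε₁ ε₂ L) (hν : IsNearStandard ν ε₁ ε₂ L) (hφμ : Integrable φ μ)
    (hφν : Integrable φ ν) (hg : Integrable g ν) :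
    ‖∫ h, φ h ∂μ - ∫ h, φ h ∂ν‖ ≤
      2 * (1 + ε₂) * ∫ h, g h ∂ν + lindebergError ε₁ ε₂ L C₁ C₂ C₃ := by
  have hε₁ := hμ.nonneg_mean_error
  have hε₂ := hμ.nonneg_secondMoment_error
  have hterms : ε₁ * (‖f.lin‖ + ‖f.linConj‖) + (1 + ε₂) * (‖f.sq‖ + ‖f.sqConj‖) +
      ε₂ * ‖f.normSq‖ ≤ ε₁ * C₁ + (1 + ε₂) * (∫ h, g h ∂ν + C₃ * (1 + ε₂)) + ε₂ * C₂ := by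
    have hpure := hφ.norm_sq_add_le hν hg
    exact add_le_add_three (mul_le_mul_of_nonneg_left hφ.linear_le hε₁)
      (mul_le_mul_of_nonneg_left hpure (by linarith)) (mul_le_mul_of_nonneg_left hφ.mixed_le hε₂)
  have hclose (ρ : Measure ℂ) [IsProbabilityMeasure ρ] (hρ : IsNearStandard ρ ε₁ ε₂ L)
      (hφρ : Integrable φ ρ) : dist (∫ h, φ h ∂ρ) (f.const + f.normSq) ≤
        C₃ * L + (ε₁ * C₁ + (1 + ε₂) * (∫ h, g h ∂ν + C₃ * (1 + ε₂)) + ε₂ * C₂) := by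
    refine (dist_triangle _ (∫ h, f.eval h ∂ρ) _).trans (add_le_add ?_ ?_)
    · simpa only [dist_eq_norm] using hφ.norm_integral_sub_integral_eval_le hρ hφρ
    · simpa only [dist_eq_norm] using (f.norm_integral_eval_sub_le hρ).trans hterms
  rw [← dist_eq_norm, lindebergError]
  refine (dist_triangle_right _ _ (f.const + f.normSq)).trans ?_
  linarith [hclose μ hμ hφμ, hclose ν hν hφν]

end IsQuadApprox

end QuadraticApproximation

section ProductMeasures

variable {ι : Type*} [DecidableEq ι] {X : ι → Type*} [∀ i, MeasurableSpace (X i)]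

theorem isProbabilityMeasure_update (μ : ∀ i, Measure (X i)) [∀ i, IsProbabilityMeasure (μ i)]
    (q : ι) (ρ : Measure (X q)) [IsProbabilityMeasure ρ] (i : ι) :
    IsProbabilityMeasure (Function.update μ q ρ i) := by
  obtain rfl | hi := eq_or_ne i q
  · rwa [Function.update_self]
  · rw [Function.update_of_ne hi]
    infer_instance

variable [Fintype ι]

theorem map_update_pi_prod (μ : ∀ i, Measure (X i)) [∀ i, IsProbabilityMeasure (μ i)] (q : ι)
    (ρ : Measure (X q)) [IsProbabilityMeasure ρ] :
    ((Measure.pi μ).prod ρ).map (fun x => Function.update x.1 q x.2) =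
      Measure.pi (Function.update μ q ρ) := by
  have := isProbabilityMeasure_update μ q ρ
  refine (Measure.pi_eq fun s hs => ?_).symm
  have hpre : (fun x : (∀ i, X i) × X q => Function.update x.1 q x.2) ⁻¹' Set.univ.pi s =
      Set.univ.pi (Function.update s q Set.univ) ×ˢ s q := by
    ext x
    simp only [Set.mem_preimage, Set.mem_pi, Set.mem_univ, true_imp_iff, Set.mem_prod,
      Function.forall_update_iff _ fun i y => y ∈ s i,
      Function.forall_update_iff _ fun i (t : Set (X i)) => x.1 i ∈ t, true_and]
    exact and_comm
  rw [Measure.map_apply measurable_update' (.univ_pi hs), hpre, Measure.prod_prod, Measure.pi_pi,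
    ← Finset.mul_prod_erase _ _ (Finset.mem_univ q),
    ← Finset.mul_prod_erase _ _ (Finset.mem_univ q)]
  simp only [Function.update_self, measure_univ, one_mul]
  rw [mul_comm]
  congr 1
  refine Finset.prod_congr rfl fun i hi => ?_
  simp only [Function.update_of_ne (Finset.ne_of_mem_erase hi)]

variable {E : Type*} [NormedAddCommGroup E]

theorem integrable_update_prod {T : (∀ i, X i) → E} (hT : StronglyMeasurable T) {C : ℝ}
    (hC : ∀ x, ‖T x‖ ≤ C) (μ : ∀ i, Measure (X i)) [∀ i, IsProbabilityMeasure (μ i)] (q : ι)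
    (ρ : Measure (X q)) [IsProbabilityMeasure ρ] :
    Integrable (fun x : (∀ i, X i) × X q => T (Function.update x.1 q x.2))
      ((Measure.pi μ).prod ρ) :=
  .of_bound (hT.comp_measurable measurable_update').aestronglyMeasurable C
    (ae_of_all _ fun _ => hC _)

variable [NormedSpace ℝ E]

theorem integral_pi_update {T : (∀ i, X i) → E} (hT : StronglyMeasurable T) {C : ℝ}
    (hC : ∀ x, ‖T x‖ ≤ C) (μ : ∀ i, Measure (X i)) [∀ i, IsProbabilityMeasure (μ i)] (q : ι)
    (ρ : Measure (X q)) [IsProbabilityMeasure ρ] :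
    ∫ x, T x ∂Measure.pi (Function.update μ q ρ) =
      ∫ x, ∫ h, T (Function.update x q h) ∂ρ ∂Measure.pi μ := by
  rw [← map_update_pi_prod, integral_map measurable_update'.aemeasurable hT.aestronglyMeasurable]
  exact integral_prod _ (integrable_update_prod hT hC μ q ρ)

theorem norm_integral_pi_update_sub_integral_pi_update_le {T : (∀ i, X i) → E}
    (hT : StronglyMeasurable T) {C : ℝ} (hC : ∀ x, ‖T x‖ ≤ C) {g : (∀ i, X i) → ℝ}
    (hg : StronglyMeasurable g) {D : ℝ} (hD : ∀ x, ‖g x‖ ≤ D) (lam : ∀ i, Measure (X i))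
    [∀ i, IsProbabilityMeasure (lam i)] (q : ι) (μ ν : Measure (X q)) [IsProbabilityMeasure μ]
    [IsProbabilityMeasure ν] {a b : ℝ}
    (h : ∀ x, ‖∫ y, T (Function.update x q y) ∂μ - ∫ y, T (Function.update x q y) ∂ν‖ ≤
      a * ∫ y, g (Function.update x q y) ∂ν + b) :
    ‖∫ x, T x ∂Measure.pi (Function.update lam q μ) -
      ∫ x, T x ∂Measure.pi (Function.update lam q ν)‖ ≤
        a * ∫ x, g x ∂Measure.pi (Function.update lam q ν) + b := by
  have hint := (integrable_update_prod hg hD lam q ν).integral_prod_left.const_mul a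
  rw [integral_pi_update hT hC, integral_pi_update hT hC, integral_pi_update hg hD,
    ← integral_sub (integrable_update_prod hT hC lam q μ).integral_prod_left
      (integrable_update_prod hT hC lam q ν).integral_prod_left]
  refine (norm_integral_le_of_norm_le (hint.add (integrable_const b)) (ae_of_all _ h)).trans_eq ?_
  rw [integral_add' hint (integrable_const b), integral_const_mul, integral_const, probReal_univ,
    one_smul]

theorem exists_mem_integral_le_div_card {Ω κ : Type*} [MeasurableSpace Ω] {P : Measure Ω}
    [IsProbabilityMeasure P] {g : κ → Ω → ℝ} {R : Finset κ} (hR : R.Nonempty)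
    (hg : ∀ q ∈ R, Integrable (g q) P) {D : ℝ} (hD : ∀ x, ∑ q ∈ R, g q x ≤ D) :
    ∃ q ∈ R, ∫ x, g q x ∂P ≤ D / R.card := by
  refine Finset.exists_le_of_sum_le hR ?_
  rw [← integral_finsetSum R hg, Finset.sum_const, nsmul_eq_mul,
    mul_div_cancel₀ _ (by exact_mod_cast hR.card_ne_zero)]
  simpa using integral_mono (integrable_finsetSum R hg) (integrable_const D) hD

end ProductMeasures

section Lindeberg

variable {ι : Type*} [Fintype ι] [DecidableEq ι] {E : Type*} [NormedAddCommGroup E]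
  [NormedSpace ℂ E] [CompleteSpace E] {T : (ι → ℂ) → E} {C D C₁ C₂ C₃ ε₁ ε₂ L : ℝ}

theorem norm_integral_pi_update_sub_le_of_isQuadApprox (hT : StronglyMeasurable T)
    (hC : ∀ x, ‖T x‖ ≤ C) {g : (ι → ℂ) → ℝ} (hg : StronglyMeasurable g) (hD : ∀ x, ‖g x‖ ≤ D)
    {q : ι} (happrox : ∀ x, ∃ f, IsQuadApprox (fun h => T (Function.update x q h)) f
      (fun h => g (Function.update x q h)) C₁ C₂ C₃)
    (lam : ι → Measure ℂ) [∀ i, IsProbabilityMeasure (lam i)] {μ ν : Measure ℂ}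
    [IsProbabilityMeasure μ] [IsProbabilityMeasure ν] (hμ : IsNearStandard μ ε₁ ε₂ L)
    (hν : IsNearStandard ν ε₁ ε₂ L) :
    ‖∫ x, T x ∂Measure.pi (Function.update lam q μ) -
      ∫ x, T x ∂Measure.pi (Function.update lam q ν)‖ ≤
        2 * (1 + ε₂) * ∫ x, g x ∂Measure.pi (Function.update lam q ν) +
          lindebergError ε₁ ε₂ L C₁ C₂ C₃ := by
  refine norm_integral_pi_update_sub_integral_pi_update_le hT hC hg hD lam q μ ν fun x => ?_
  obtain ⟨f, hf⟩ := happrox x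
  have hmeas : Measurable fun h : ℂ => Function.update x q h := measurable_update x
  have hTint (ρ : Measure ℂ) [IsProbabilityMeasure ρ] :
      Integrable (fun h => T (Function.update x q h)) ρ :=
    .of_bound (hT.comp_measurable hmeas).aestronglyMeasurable C (ae_of_all _ fun _ => hC _)
  exact hf.norm_integral_sub_integral_le hμ hν (hTint μ) (hTint ν)
    (.of_bound (hg.comp_measurable hmeas).aestronglyMeasurable D (ae_of_all _ fun _ => hD _))

theorem norm_integral_pi_sub_integral_pi_le (hT : StronglyMeasurable T) (hC : ∀ x, ‖T x‖ ≤ C)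
    {g : ι → (ι → ℂ) → ℝ} (hg : ∀ q, StronglyMeasurable (g q)) (hg₀ : ∀ q x, 0 ≤ g q x)
    (hD : ∀ x, ∑ q, g q x ≤ D)
    (happrox : ∀ q x, ∃ f, IsQuadApprox (fun h => T (Function.update x q h)) f
      (fun h => g q (Function.update x q h)) C₁ C₂ C₃)
    {μ ν : ι → Measure ℂ} [∀ q, IsProbabilityMeasure (μ q)] [∀ q, IsProbabilityMeasure (ν q)]
    (hμ : ∀ q, IsNearStandard (μ q) ε₁ ε₂ L) (hν : ∀ q, IsNearStandard (ν q) ε₁ ε₂ L) :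
    ‖∫ x, T x ∂Measure.pi μ - ∫ x, T x ∂Measure.pi ν‖ ≤
      2 * (1 + ε₂) * (D * harmonic (Fintype.card ι)) +
        Fintype.card ι * lindebergError ε₁ ε₂ L C₁ C₂ C₃ := by
  have hsumR (R : Finset ι) x : ∑ q ∈ R, g q x ≤ D :=
    (Finset.sum_le_univ_sum_of_nonneg fun q => hg₀ q x).trans (hD x)
  have hgD q x : ‖g q x‖ ≤ D := by
    simpa only [Real.norm_of_nonneg (hg₀ q x), Finset.sum_singleton] using hsumR {q} x
  have hinst (R : Finset ι) (q : ι) : IsProbabilityMeasure (R.piecewise ν μ q) :=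
    R.piecewise_cases ν μ (p := fun ρ => IsProbabilityMeasure ρ) inferInstance inferInstance
  suffices ∀ R : Finset ι, ‖∫ x, T x ∂Measure.pi μ - ∫ x, T x ∂Measure.pi (R.piecewise ν μ)‖ ≤
      2 * (1 + ε₂) * (D * harmonic R.card) + R.card * lindebergError ε₁ ε₂ L C₁ C₂ C₃ by
    simpa only [Finset.piecewise_univ, Finset.card_univ] using this Finset.univ
  intro R
  induction hk : R.card generalizing R with
  | zero =>
    obtain rfl := Finset.card_eq_zero.1 hk
    simp
  | succ k ih =>
    obtain ⟨q, hq, hgq⟩ := exists_mem_integral_le_div_card (P := Measure.pi (R.piecewise ν μ))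
      (Finset.card_pos.1 (hk ▸ k.succ_pos))
      (fun q _ => .of_bound (hg q).aestronglyMeasurable D (ae_of_all _ (hgD q))) (hsumR R)
    obtain ⟨S, hqS, rfl⟩ : ∃ S, q ∉ S ∧ insert q S = R :=
      ⟨R.erase q, R.notMem_erase q, Finset.insert_erase hq⟩
    have hS : S.card = k := by simpa only [Finset.card_insert_of_notMem hqS, Nat.succ_inj] using hk
    have hstep := norm_integral_pi_update_sub_le_of_isQuadApprox hT hC (hg q) (hgD q)
      (happrox q) (S.piecewise ν μ) (hμ q) (hν q)
    have hupdate : Function.update (S.piecewise ν μ) q (μ q) = S.piecewise ν μ := by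
      rw [← S.piecewise_eq_of_notMem ν μ hqS, Function.update_eq_self]
    rw [hupdate, ← Finset.piecewise_insert] at hstep
    refine (norm_sub_le_norm_sub_add_norm_sub _ _ _).trans
      ((add_le_add (ih S hS) (hstep.trans (add_le_add_left
        (mul_le_mul_of_nonneg_left hgq ?_) _))).trans_eq ?_)
    · linarith [(hμ q).nonneg_secondMoment_error]
    · rw [hk, harmonic_succ]
      push_cast
      ring

end Lindeberg

section Resolvents

open Complex

theorem continuous_resolvent_comp {X 𝓐 : Type*} [TopologicalSpace X] [NormedRing 𝓐]
    [NormedAlgebra ℂ 𝓐] [CompleteSpace 𝓐] {f : X → 𝓐} (hf : Continuous f) {w : ℂ}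
    (hw : ∀ x, w ∈ resolventSet ℂ (f x)) : Continuous fun x => resolvent (f x) w := by
  refine continuous_iff_continuousAt.2 fun x => ?_
  obtain ⟨u, hu⟩ := hw x
  have hinv := NormedRing.inverse_continuousAt u
  rw [hu] at hinv
  exact ContinuousAt.comp (f := fun x => algebraMap ℂ 𝓐 w - f x) hinv
    (continuous_const.sub hf).continuousAt

section Expansion

variable {𝓐 : Type*} [Ring 𝓐] [Algebra ℂ 𝓐] {a Δ : 𝓐} {w : ℂ}

theorem resolvent_add_eq (ha : w ∈ resolventSet ℂ a) (haΔ : w ∈ resolventSet ℂ (a + Δ)) :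
    resolvent (a + Δ) w = resolvent a w + resolvent (a + Δ) w * Δ * resolvent a w := by
  have hΔ : Δ = (algebraMap ℂ 𝓐 w - a) - (algebraMap ℂ 𝓐 w - (a + Δ)) := by abel
  conv_rhs => rw [hΔ]
  rw [mul_sub, sub_mul, ← hΔ, mul_assoc, resolvent, resolvent, Ring.mul_inverse_cancel _ ha,
    Ring.inverse_mul_cancel _ haΔ, mul_one, one_mul, add_sub_cancel]

theorem resolvent_add_eq_third_order (ha : w ∈ resolventSet ℂ a)
    (haΔ : w ∈ resolventSet ℂ (a + Δ)) :
    resolvent (a + Δ) w = resolvent a w + resolvent a w * Δ * resolvent a w +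
      resolvent a w * Δ * resolvent a w * Δ * resolvent a w +
      resolvent (a + Δ) w * Δ * resolvent a w * Δ * resolvent a w * Δ * resolvent a w := by
  have h := resolvent_add_eq ha haΔ
  set G := resolvent a w
  set G' := resolvent (a + Δ) w
  calc G' = G + (G + (G + G' * Δ * G) * Δ * G) * Δ * G := by rw [← h, ← h, ← h]
    _ = _ := by noncomm_ring

end Expansion

variable {𝓐 : Type*} [CStarAlgebra 𝓐] {a : 𝓐} {w : ℂ}

theorem mem_resolventSet_of_im_ne_zero (ha : IsSelfAdjoint a) (hw : w.im ≠ 0) :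
    w ∈ resolventSet ℂ a :=
  spectrum.mem_resolventSet_iff.2 <| spectrum.notMem_iff.1 fun h =>
    hw (ha.im_eq_zero_of_mem_spectrum h)

theorem norm_resolvent_le (ha : IsSelfAdjoint a) (hw : w.im ≠ 0) :
    ‖resolvent a w‖ ≤ |w.im|⁻¹ := by
  have him {x : ℂ} (hx : x ∈ spectrum ℂ a) : (w - x).im = w.im := by
    rw [sub_im, ha.im_eq_zero_of_mem_spectrum hx, sub_zero]
  have hne {x : ℂ} (hx : x ∈ spectrum ℂ a) : w - x ≠ 0 := fun h => hw (by rw [← him hx, h, zero_im])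
  have hcfc : resolvent a w = cfc (fun x => (w - x)⁻¹) a := by
    rw [cfc_inv (fun x => w - x) a fun x hx => hne hx, cfc_sub _ _ a, cfc_const w a, cfc_id' ℂ a,
      resolvent]
  rw [hcfc]
  refine norm_cfc_le (by positivity) fun x hx => ?_
  rw [norm_inv, ← him hx]
  exact inv_anti₀ (abs_pos.2 (by rwa [him hx])) (abs_im_le_norm _)

theorem norm_resolvent_sub_resolvent_add_le {Δ : 𝓐} (ha : IsSelfAdjoint a) (hΔ : IsSelfAdjoint Δ)
    (hw : w.im ≠ 0) :
    ‖resolvent a w - resolvent (a + Δ) w‖ ≤ |w.im|⁻¹ * ‖Δ‖ * |w.im|⁻¹ := by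
  rw [norm_sub_rev, resolvent_add_eq (mem_resolventSet_of_im_ne_zero ha hw)
    (mem_resolventSet_of_im_ne_zero (ha.add hΔ) hw), add_sub_cancel_left]
  exact norm_mul_le_of_le (norm_mul_le_of_le (norm_resolvent_le (ha.add hΔ) hw) le_rfl)
    (norm_resolvent_le ha hw)

end Resolvents

section MatrixNorms

open scoped Matrix.Norms.L2Operator Matrix

variable {k l m n : Type*} [Fintype k] [Fintype l] [Fintype m] [Fintype n] [DecidableEq n]

theorem norm_toLp_col_le (M : Matrix m n ℂ) (j : n) : ‖WithLp.toLp 2 (M.col j)‖ ≤ ‖M‖ := by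
  simpa using M.l2_opNorm_mulVec (EuclideanSpace.single j 1)

theorem norm_entry_le (M : Matrix m n ℂ) (i : m) (j : n) : ‖M i j‖ ≤ ‖M‖ :=
  (PiLp.norm_apply_le (WithLp.toLp 2 (M.col j)) i).trans (norm_toLp_col_le M j)

theorem norm_trace_le (M : Matrix n n ℂ) : ‖M.trace‖ ≤ Fintype.card n * ‖M‖ := by
  have h := norm_sum_le_of_le Finset.univ fun i _ => norm_entry_le M i i
  rwa [Finset.sum_const, Finset.card_univ, nsmul_eq_mul] at h

theorem sum_norm_mul_norm_le (M N : Matrix m n ℂ) :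
    ∑ j, ∑ i, ‖M i j‖ * ‖N i j‖ ≤ Fintype.card n * (‖M‖ * ‖N‖) := by
  rw [← nsmul_eq_mul, ← Finset.card_univ]
  refine Finset.sum_le_card_nsmul _ _ _ fun j _ => ?_
  calc ∑ i, ‖M i j‖ * ‖N i j‖
      ≤ √(∑ i, ‖M i j‖ ^ 2) * √(∑ i, ‖N i j‖ ^ 2) := Real.sum_mul_le_sqrt_mul_sqrt _ _ _
    _ = ‖WithLp.toLp 2 (M.col j)‖ * ‖WithLp.toLp 2 (N.col j)‖ := by
      rw [EuclideanSpace.norm_eq, EuclideanSpace.norm_eq]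
      rfl
    _ ≤ ‖M‖ * ‖N‖ := by gcongr <;> exact norm_toLp_col_le _ _

variable [DecidableEq m]

theorem norm_single_one_le (i : m) (j : n) : ‖(Matrix.single i j 1 : Matrix m n ℂ)‖ ≤ 1 := by
  have h := Matrix.l2_opNorm_conjTranspose_mul_self (Matrix.single i j 1 : Matrix m n ℂ)
  rw [Matrix.conjTranspose_single, Matrix.single_mul_single_same, star_one, one_mul,
    ← Matrix.diagonal_single, Matrix.l2_opNorm_diagonal, Pi.norm_single, norm_one] at h
  nlinarith [norm_nonneg (Matrix.single i j 1 : Matrix m n ℂ)]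

variable [DecidableEq k] [DecidableEq l]

/-- The trace norm of `E` is at most `κ`, in dual form. The bound on the operator norm of `E` would
follow from `trace_le`; including it avoids the duality argument. -/
structure TraceNormLE (E : Matrix m m ℂ) (κ : ℝ) : Prop where
  norm_le : ‖E‖ ≤ κ
  trace_le : ∀ M : Matrix m m ℂ, ‖(M * E).trace‖ ≤ κ * ‖M‖

namespace TraceNormLE

variable {E F : Matrix m m ℂ} {κ κ' : ℝ}

theorem nonneg (hE : TraceNormLE E κ) : 0 ≤ κ :=
  (norm_nonneg _).trans hE.norm_le

theorem mono (hE : TraceNormLE E κ) (h : κ ≤ κ') : TraceNormLE E κ' :=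
  ⟨hE.norm_le.trans h, fun M =>
    (hE.trace_le M).trans (mul_le_mul_of_nonneg_right h (norm_nonneg M))⟩

theorem add (hE : TraceNormLE E κ) (hF : TraceNormLE F κ') : TraceNormLE (E + F) (κ + κ') where
  norm_le := norm_add_le_of_le hE.norm_le hF.norm_le
  trace_le M := by
    rw [mul_add, Matrix.trace_add, add_mul]
    exact norm_add_le_of_le (hE.trace_le M) (hF.trace_le M)

theorem smul (hE : TraceNormLE E κ) (c : ℂ) : TraceNormLE (c • E) (‖c‖ * κ) where
  norm_le := (norm_smul_le _ _).trans (mul_le_mul_of_nonneg_left hE.norm_le (norm_nonneg c))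
  trace_le M := by
    rw [Matrix.mul_smul, Matrix.trace_smul, norm_smul, mul_assoc]
    exact mul_le_mul_of_nonneg_left (hE.trace_le M) (norm_nonneg c)

theorem conjTranspose (hE : TraceNormLE E κ) : TraceNormLE Eᴴ κ where
  norm_le := (Matrix.l2_opNorm_conjTranspose E).trans_le hE.norm_le
  trace_le M := by
    rw [Matrix.trace_mul_comm, ← M.conjTranspose_conjTranspose, ← Matrix.conjTranspose_mul,
      Matrix.trace_conjTranspose, norm_star, Matrix.l2_opNorm_conjTranspose]
    exact hE.trace_le Mᴴ

theorem norm_trace_mul_mul_le (hE : TraceNormLE E κ) {M N : Matrix m m ℂ} {a b : ℝ}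
    (hM : ‖M‖ ≤ a) (hN : ‖N‖ ≤ b) : ‖(M * E * N).trace‖ ≤ κ * (a * b) := by
  rw [Matrix.trace_mul_comm, ← mul_assoc]
  refine (hE.trace_le _).trans (mul_le_mul_of_nonneg_left ?_ hE.nonneg)
  rw [mul_comm a b]
  exact norm_mul_le_of_le hN hM

theorem norm_trace_mul_mul_mul_mul_le (hE : TraceNormLE E κ) (hF : TraceNormLE F κ')
    {M N O : Matrix m m ℂ} {a b c : ℝ} (hM : ‖M‖ ≤ a) (hN : ‖N‖ ≤ b) (hO : ‖O‖ ≤ c) :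
    ‖(M * E * N * F * O).trace‖ ≤ κ * κ' * (a * b * c) :=
  (hF.norm_trace_mul_mul_le (norm_mul_le_of_le (norm_mul_le_of_le hM hE.norm_le) hN) hO).trans_eq
    (by ring)

end TraceNormLE

theorem traceNormLE_mul_single_mul (P : Matrix m k ℂ) (Q : Matrix l m ℂ) (i : k) (j : l) :
    TraceNormLE (P * Matrix.single i j (1 : ℂ) * Q) (‖P‖ * ‖Q‖) where
  norm_le := by
    refine (Matrix.l2_opNorm_mul _ _).trans (mul_le_mul_of_nonneg_right ?_ (norm_nonneg Q))
    exact (Matrix.l2_opNorm_mul _ _).trans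
      (mul_le_of_le_one_right (norm_nonneg P) (norm_single_one_le i j))
  trace_le M := by
    have htrace : (M * (P * Matrix.single i j (1 : ℂ) * Q)).trace = (Q * (M * P)) j i := by
      rw [← Matrix.mul_assoc, ← Matrix.mul_assoc, Matrix.trace_mul_comm, ← Matrix.mul_assoc,
        Matrix.trace_mul_single, MulOpposite.op_one, one_smul]
    rw [htrace, mul_right_comm, mul_comm (‖P‖ * ‖M‖), mul_comm ‖P‖]
    refine (norm_entry_le _ j i).trans ((Matrix.l2_opNorm_mul _ _).trans ?_)
    exact mul_le_mul_of_nonneg_left (Matrix.l2_opNorm_mul _ _) (norm_nonneg Q)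

end MatrixNorms

section HermitianPencils

open scoped Matrix.Norms.L2Operator Matrix

variable {m : Type*}

/-- The Hermitian matrix `M + Mᴴ`, that is, twice the Hermitian part of `M`. -/
def addAdjoint (M : Matrix m m ℂ) : Matrix m m ℂ :=
  M + Mᴴ

theorem isSelfAdjoint_addAdjoint (M : Matrix m m ℂ) : IsSelfAdjoint (addAdjoint M) :=
  IsSelfAdjoint.add_star_self M

theorem addAdjoint_add (M N : Matrix m m ℂ) :
    addAdjoint (M + N) = addAdjoint M + addAdjoint N := by
  simp only [addAdjoint, Matrix.conjTranspose_add, add_add_add_comm]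

theorem addAdjoint_smul (h : ℂ) (E : Matrix m m ℂ) :
    addAdjoint (h • E) = h • E + conj h • Eᴴ := by
  rw [addAdjoint, Matrix.conjTranspose_smul, starRingEnd_apply]

/-- The Hermitian matrix `∑ q, (x q • E q + conj (x q) • (E q)ᴴ)`, as a function of the scalars
`x`. -/
def hermPencil {ι : Type*} [Fintype ι] (E : ι → Matrix m m ℂ) (x : ι → ℂ) : Matrix m m ℂ :=
  addAdjoint (Fintype.linearCombination ℂ E x)

theorem hermPencil_update {ι : Type*} [Fintype ι] [DecidableEq ι] (E : ι → Matrix m m ℂ)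
    (x : ι → ℂ) (q : ι) (h : ℂ) :
    hermPencil E (Function.update x q h) =
      hermPencil E (Function.update x q 0) + addAdjoint (h • E q) := by
  have hx : Function.update x q h = Function.update x q 0 + Pi.single q h := by
    ext i
    obtain rfl | hi := eq_or_ne i q
    · simp
    · simp [hi]
  rw [hermPencil, hx, map_add, Fintype.linearCombination_apply_single, addAdjoint_add, hermPencil]

variable [Fintype m]

/-- The trace in the second order terms of the expansion of a resolvent `G`. -/
def sandwichTrace (G E F : Matrix m m ℂ) : ℂ :=
  (G * E * G * F * G).trace

/-- The coefficients, up to second order in `h`, of the trace of the resolvent `G` of a matrix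
perturbed by `h • E + conj h • Eᴴ`. -/
def resolventQuadPoly (G E : Matrix m m ℂ) : QuadPoly ℂ where
  const := G.trace
  lin := (G * E * G).trace
  linConj := (G * Eᴴ * G).trace
  sq := sandwichTrace G E E
  sqConj := sandwichTrace G Eᴴ Eᴴ
  normSq := sandwichTrace G E Eᴴ + sandwichTrace G Eᴴ E

/-- The size of the coefficients `sq` and `sqConj` of `resolventQuadPoly`, which are not controlled
by matching the moments `E h` and `E |h|²`. -/
noncomputable def unmatchedTerm (G E : Matrix m m ℂ) : ℝ :=
  ‖sandwichTrace G E E‖ + ‖sandwichTrace G Eᴴ Eᴴ‖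

theorem eval_resolventQuadPoly (G E : Matrix m m ℂ) (h : ℂ) :
    (resolventQuadPoly G E).eval h = G.trace + (G * addAdjoint (h • E) * G).trace +
      sandwichTrace G (addAdjoint (h • E)) (addAdjoint (h • E)) := by
  have hnorm : ((‖h‖ ^ 2 : ℝ) : ℂ) = h * conj h := by
    rw [Complex.mul_conj, Complex.normSq_eq_norm_sq]
  simp only [QuadPoly.eval, resolventQuadPoly, sandwichTrace, hnorm, addAdjoint_smul, mul_add,
    add_mul, Matrix.mul_smul, Matrix.smul_mul, Matrix.trace_add, Matrix.trace_smul, smul_eq_mul]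
  ring

variable {k l : Type*} [Fintype k] [Fintype l] [DecidableEq k] [DecidableEq l]

theorem sandwichTrace_mul_single_mul (G : Matrix m m ℂ) (P : Matrix m k ℂ)
    (Q : Matrix l m ℂ) (i : k) (j : l) :
    sandwichTrace G (P * Matrix.single i j (1 : ℂ) * Q) (P * Matrix.single i j (1 : ℂ) * Q) =
      (Q * G * P) j i * (Q * (G * G) * P) j i := by
  have hassoc : G * (P * Matrix.single i j (1 : ℂ) * Q) * G *
      (P * Matrix.single i j (1 : ℂ) * Q) * G = G * P *
        (Matrix.single i j (1 : ℂ) * (Q * G * P) * Matrix.single i j (1 : ℂ)) * (Q * G) := by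
    simp only [Matrix.mul_assoc]
  rw [sandwichTrace, hassoc, Matrix.single_mul_mul_single, Matrix.trace_mul_comm,
    ← Matrix.mul_assoc, Matrix.trace_mul_single, one_mul, mul_one, op_smul_eq_mul, mul_comm]
  simp only [Matrix.mul_assoc]

variable [DecidableEq m] {H E Δ G G' : Matrix m m ℂ} {κ δ η : ℝ} {w : ℂ}

theorem TraceNormLE.addAdjoint (hE : TraceNormLE E κ) : TraceNormLE (addAdjoint E) (2 * κ) := by
  rw [two_mul]
  exact hE.add hE.conjTranspose

theorem norm_trace_resolvent_add_sub_le (hH : IsSelfAdjoint H) (hΔ : IsSelfAdjoint Δ)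
    (hΔκ : TraceNormLE Δ κ) (hw : w.im ≠ 0) :
    ‖(resolvent (H + Δ) w).trace - ((resolvent H w).trace +
      (resolvent H w * Δ * resolvent H w).trace + sandwichTrace (resolvent H w) Δ Δ)‖ ≤
      κ ^ 3 * |w.im|⁻¹ ^ 4 := by
  have hG := norm_resolvent_le hH hw
  have hG' := norm_resolvent_le (hH.add hΔ) hw
  have hexp := resolvent_add_eq_third_order (mem_resolventSet_of_im_ne_zero hH hw)
    (mem_resolventSet_of_im_ne_zero (hH.add hΔ) hw)
  rw [hexp, Matrix.trace_add, Matrix.trace_add, Matrix.trace_add, sandwichTrace,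
    add_sub_cancel_left]
  refine (hΔκ.norm_trace_mul_mul_mul_mul_le hΔκ
    (norm_mul_le_of_le (norm_mul_le_of_le hG' hΔκ.norm_le) hG) hG hG).trans_eq (by ring)

theorem norm_sandwichTrace_sub_le (hE : TraceNormLE E κ) (hG : ‖G‖ ≤ η) (hG' : ‖G'‖ ≤ η)
    (hδ : ‖G - G'‖ ≤ δ) :
    ‖sandwichTrace G E E - sandwichTrace G' E E‖ ≤ 3 * κ ^ 2 * η ^ 2 * δ := by
  have htelescope : sandwichTrace G E E - sandwichTrace G' E E =
      ((G - G') * E * G * E * G).trace + (G' * E * (G - G') * E * G).trace +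
        (G' * E * G' * E * (G - G')).trace := by
    simp only [sandwichTrace, ← Matrix.trace_add, ← Matrix.trace_sub]
    congr 1
    noncomm_ring
  rw [htelescope]
  refine (norm_add_le_of_le (norm_add_le_of_le
    (hE.norm_trace_mul_mul_mul_mul_le hE hδ hG hG)
    (hE.norm_trace_mul_mul_mul_mul_le hE hG' hδ hG))
    (hE.norm_trace_mul_mul_mul_mul_le hE hG' hG' hδ)).trans_eq (by ring)

theorem unmatchedTerm_le_add (hE : TraceNormLE E κ) (hG : ‖G‖ ≤ η) (hG' : ‖G'‖ ≤ η)
    (hδ : ‖G - G'‖ ≤ δ) :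
    unmatchedTerm G E ≤ unmatchedTerm G' E + 6 * κ ^ 2 * η ^ 2 * δ := by
  have h := norm_le_norm_add_norm_sub' (sandwichTrace G E E) (sandwichTrace G' E E)
  have hconj := norm_le_norm_add_norm_sub' (sandwichTrace G Eᴴ Eᴴ) (sandwichTrace G' Eᴴ Eᴴ)
  rw [unmatchedTerm, unmatchedTerm]
  linarith [norm_sandwichTrace_sub_le hE hG hG' hδ,
    norm_sandwichTrace_sub_le hE.conjTranspose hG hG' hδ]

theorem isQuadApprox_trace_resolvent (hH : IsSelfAdjoint H) (hE : TraceNormLE E κ)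
    (hw : w.im ≠ 0) :
    IsQuadApprox (fun h => (resolvent (H + addAdjoint (h • E)) w).trace)
      (resolventQuadPoly (resolvent H w) E)
      (fun h => unmatchedTerm (resolvent (H + addAdjoint (h • E)) w) E)
      (2 * κ * |w.im|⁻¹ ^ 2) (2 * κ ^ 2 * |w.im|⁻¹ ^ 3) (12 * κ ^ 3 * |w.im|⁻¹ ^ 4) := by
  have hG := norm_resolvent_le hH hw
  have hκ := hE.nonneg
  have hΔ (h : ℂ) := isSelfAdjoint_addAdjoint (h • E)
  have hΔκ (h : ℂ) : TraceNormLE (addAdjoint (h • E)) (2 * (‖h‖ * κ)) := (hE.smul h).addAdjoint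
  refine ⟨?_, ?_, fun h => ?_, fun h => ?_⟩
  · exact (add_le_add (hE.norm_trace_mul_mul_le hG hG)
      (hE.conjTranspose.norm_trace_mul_mul_le hG hG)).trans_eq (by ring)
  · exact (norm_add_le_of_le (hE.norm_trace_mul_mul_mul_mul_le hE.conjTranspose hG hG hG)
      (hE.conjTranspose.norm_trace_mul_mul_mul_mul_le hE hG hG hG)).trans_eq (by ring)
  · have hδ : ‖resolvent H w - resolvent (H + addAdjoint (h • E)) w‖ ≤
        |w.im|⁻¹ * (2 * (‖h‖ * κ)) * |w.im|⁻¹ :=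
      (norm_resolvent_sub_resolvent_add_le hH (hΔ h) hw).trans
        (by gcongr; exact (hΔκ h).norm_le)
    refine (unmatchedTerm_le_add hE hG (norm_resolvent_le (hH.add (hΔ h)) hw) hδ).trans_eq ?_
    ring
  · rw [eval_resolventQuadPoly]
    refine (norm_trace_resolvent_add_sub_le hH (hΔ h) (hΔκ h) hw).trans ?_
    have : 0 ≤ κ ^ 3 * |w.im|⁻¹ ^ 4 * ‖h‖ ^ 3 := by positivity
    linarith

theorem sum_norm_sandwichTrace_mul_single_mul_le (P : Matrix m k ℂ) (Q : Matrix l m ℂ) :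
    ∑ i : k, ∑ j : l, ‖sandwichTrace G (P * Matrix.single i j (1 : ℂ) * Q)
      (P * Matrix.single i j (1 : ℂ) * Q)‖ ≤
      Fintype.card k * ((‖P‖ * ‖Q‖) ^ 2 * ‖G‖ ^ 3) := by
  have hmul (M : Matrix m m ℂ) : ‖Q * M * P‖ ≤ ‖Q‖ * ‖M‖ * ‖P‖ :=
    (Matrix.l2_opNorm_mul _ _).trans
      (mul_le_mul_of_nonneg_right (Matrix.l2_opNorm_mul _ _) (norm_nonneg P))
  simp only [sandwichTrace_mul_single_mul, norm_mul]
  refine (sum_norm_mul_norm_le _ _).trans (mul_le_mul_of_nonneg_left ?_ (Nat.cast_nonneg _))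
  calc ‖Q * G * P‖ * ‖Q * (G * G) * P‖
      ≤ (‖Q‖ * ‖G‖ * ‖P‖) * (‖Q‖ * (‖G‖ * ‖G‖) * ‖P‖) := by
        gcongr
        · exact hmul G
        · exact (hmul (G * G)).trans (by gcongr; exact norm_mul_le G G)
    _ = (‖P‖ * ‖Q‖) ^ 2 * ‖G‖ ^ 3 := by ring

theorem sum_unmatchedTerm_mul_single_mul_le (P : Matrix m k ℂ) (Q : Matrix l m ℂ) :
    ∑ i : k, ∑ j : l, unmatchedTerm G (P * Matrix.single i j (1 : ℂ) * Q) ≤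
      (Fintype.card k + Fintype.card l) * ((‖P‖ * ‖Q‖) ^ 2 * ‖G‖ ^ 3) := by
  have hconj (i : k) (j : l) : (P * Matrix.single i j (1 : ℂ) * Q)ᴴ =
      Qᴴ * Matrix.single j i (1 : ℂ) * Pᴴ := by
    rw [Matrix.conjTranspose_mul, Matrix.conjTranspose_mul, Matrix.conjTranspose_single, star_one,
      Matrix.mul_assoc]
  have hadj := sum_norm_sandwichTrace_mul_single_mul_le (G := G) Qᴴ Pᴴ
  rw [Finset.sum_comm, Matrix.l2_opNorm_conjTranspose, Matrix.l2_opNorm_conjTranspose,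
    mul_comm ‖Q‖] at hadj
  simp only [unmatchedTerm, Finset.sum_add_distrib, hconj, add_mul]
  exact add_le_add (sum_norm_sandwichTrace_mul_single_mul_le P Q) hadj

section Pencil

variable {ι : Type*} [Fintype ι] (E : ι → Matrix m m ℂ)

theorem norm_resolvent_hermPencil_le (hw : w.im ≠ 0) (x : ι → ℂ) :
    ‖resolvent (hermPencil E x) w‖ ≤ |w.im|⁻¹ :=
  norm_resolvent_le (isSelfAdjoint_addAdjoint _) hw

theorem continuous_resolvent_hermPencil (hw : w.im ≠ 0) :
    Continuous fun x => resolvent (hermPencil E x) w :=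
  continuous_resolvent_comp (by unfold hermPencil addAdjoint Fintype.linearCombination; fun_prop)
    fun _ => mem_resolventSet_of_im_ne_zero (isSelfAdjoint_addAdjoint _) hw

theorem norm_trace_resolvent_hermPencil_le (hw : w.im ≠ 0) (x : ι → ℂ) :
    ‖(resolvent (hermPencil E x) w).trace‖ ≤ Fintype.card m * |w.im|⁻¹ :=
  (norm_trace_le _).trans
    (mul_le_mul_of_nonneg_left (norm_resolvent_hermPencil_le E hw x) (Nat.cast_nonneg _))

theorem integrable_trace_resolvent_hermPencil (hw : w.im ≠ 0) (ρ : Measure (ι → ℂ))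
    [IsFiniteMeasure ρ] : Integrable (fun x => (resolvent (hermPencil E x) w).trace) ρ :=
  .of_bound (continuous_resolvent_hermPencil E hw).matrix_trace.aestronglyMeasurable _
    (ae_of_all _ (norm_trace_resolvent_hermPencil_le E hw))

theorem norm_integral_trace_resolvent_hermPencil_sub_le {μ ν : ι → Measure ℂ}
    [∀ q, IsProbabilityMeasure (μ q)] [∀ q, IsProbabilityMeasure (ν q)]
    {ε₁ ε₂ L : ℝ} (hμ : ∀ q, IsNearStandard (μ q) ε₁ ε₂ L)
    (hν : ∀ q, IsNearStandard (ν q) ε₁ ε₂ L) (hE : ∀ q, TraceNormLE (E q) κ) (hw : w.im ≠ 0)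
    {D : ℝ} (hD : ∀ G : Matrix m m ℂ, ‖G‖ ≤ |w.im|⁻¹ → ∑ q, unmatchedTerm G (E q) ≤ D) :
    ‖∫ x, (resolvent (hermPencil E x) w).trace ∂Measure.pi μ -
      ∫ x, (resolvent (hermPencil E x) w).trace ∂Measure.pi ν‖ ≤
      2 * (1 + ε₂) * (D * harmonic (Fintype.card ι)) + Fintype.card ι * lindebergError ε₁ ε₂ L
        (2 * κ * |w.im|⁻¹ ^ 2) (2 * κ ^ 2 * |w.im|⁻¹ ^ 3) (12 * κ ^ 3 * |w.im|⁻¹ ^ 4) := by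
  classical
  have hcont := continuous_resolvent_hermPencil E hw
  refine norm_integral_pi_sub_integral_pi_le (T := fun x => (resolvent (hermPencil E x) w).trace)
    (g := fun q x => unmatchedTerm (resolvent (hermPencil E x) w) (E q))
    hcont.matrix_trace.stronglyMeasurable (norm_trace_resolvent_hermPencil_le E hw)
    (fun q => Continuous.stronglyMeasurable ?_) (fun q x => by unfold unmatchedTerm; positivity)
    (fun x => hD _ (norm_resolvent_hermPencil_le E hw x)) (fun q x => ?_) hμ hν
  · unfold unmatchedTerm sandwichTrace
    fun_prop
  · have happrox := isQuadApprox_trace_resolvent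
      (isSelfAdjoint_addAdjoint (Fintype.linearCombination ℂ E (Function.update x q 0))) (hE q) hw
    change IsQuadApprox (fun h => (resolvent (hermPencil E _ + _) w).trace) _
      (fun h => unmatchedTerm (resolvent (hermPencil E _ + _) w) _) _ _ _ at happrox
    simp only [← hermPencil_update] at happrox
    exact ⟨_, happrox⟩

end Pencil

end HermitianPencils

section Hermitization

open scoped Matrix.Norms.L2Operator Matrix

theorem mul_resolvent_eq {R A : Type*} [CommRing R] [Ring A] [Algebra R A] {a : A} {w : R}
    (ha : w ∈ resolventSet R a) : a * resolvent a w = w • resolvent a w - 1 := by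
  have h := Ring.mul_inverse_cancel _ ha
  rw [sub_mul, Algebra.algebraMap_eq_smul_one, smul_one_mul] at h
  rw [← h, resolvent, Algebra.algebraMap_eq_smul_one, sub_sub_cancel]

variable {F k l : Type*} [Field F] [Fintype k] [Fintype l]

theorem trace_fromBlocks (A : Matrix k k F) (B : Matrix k l F) (C : Matrix l k F)
    (D : Matrix l l F) : (Matrix.fromBlocks A B C D).trace = A.trace + D.trace := by
  simp [Matrix.trace, Fintype.sum_sum_type]

variable [DecidableEq k] [DecidableEq l]

theorem resolvent_fromBlocks (Y : Matrix k l F) (Y' : Matrix l k F) {w : F} (hw₀ : w ≠ 0)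
    (hw : w ^ 2 ∈ resolventSet F (Y * Y')) :
    resolvent (Matrix.fromBlocks 0 Y Y' 0) w = Matrix.fromBlocks
      (w • resolvent (Y * Y') (w ^ 2)) (resolvent (Y * Y') (w ^ 2) * Y)
      (Y' * resolvent (Y * Y') (w ^ 2)) (w⁻¹ • (1 + Y' * resolvent (Y * Y') (w ^ 2) * Y)) := by
  have hYR := mul_resolvent_eq hw
  set R := resolvent (Y * Y') (w ^ 2)
  have hblocks : algebraMap F (Matrix (k ⊕ l) (k ⊕ l) F) w - Matrix.fromBlocks 0 Y Y' 0 =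
      Matrix.fromBlocks (w • 1) (-Y) (-Y') (w • 1) := by
    rw [Algebra.algebraMap_eq_smul_one, ← Matrix.fromBlocks_one, Matrix.fromBlocks_smul,
      sub_eq_add_neg, Matrix.fromBlocks_neg, Matrix.fromBlocks_add]
    simp
  rw [resolvent, ← Matrix.nonsing_inv_eq_ringInverse, hblocks]
  refine Matrix.inv_eq_right_inv ?_
  rw [Matrix.fromBlocks_multiply, ← Matrix.fromBlocks_one]
  congr 1
  · simp only [Matrix.smul_mul, Matrix.one_mul, Matrix.neg_mul, ← Matrix.mul_assoc, hYR, smul_smul]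
    rw [← sq, neg_sub, add_sub_cancel]
  · simp only [Matrix.smul_mul, Matrix.one_mul, Matrix.neg_mul, Matrix.mul_smul, Matrix.mul_add,
      Matrix.mul_one, ← Matrix.mul_assoc]
    rw [hYR, Matrix.sub_mul, Matrix.one_mul, ← neg_add, add_sub_cancel, Matrix.smul_mul, smul_neg,
      smul_smul, sq, inv_mul_cancel_left₀ hw₀, add_neg_cancel]
  · simp
  · simp only [Matrix.smul_mul, Matrix.one_mul, Matrix.neg_mul, smul_smul, mul_inv_cancel₀ hw₀,
      one_smul, ← Matrix.mul_assoc]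
    abel

theorem trace_resolvent_fromBlocks (Y : Matrix k l F) (Y' : Matrix l k F) {w : F} (hw₀ : w ≠ 0)
    (hw : w ^ 2 ∈ resolventSet F (Y * Y')) :
    (resolvent (Matrix.fromBlocks 0 Y Y' 0) w).trace =
      2 * w * (resolvent (Y * Y') (w ^ 2)).trace + (Fintype.card l - Fintype.card k) / w := by
  rw [resolvent_fromBlocks Y Y' hw₀ hw, trace_fromBlocks, Matrix.trace_smul,
    Matrix.trace_smul, Matrix.trace_add, Matrix.trace_one, Matrix.trace_mul_comm (Y' * _) Y,
    ← Matrix.mul_assoc, mul_resolvent_eq hw, Matrix.trace_sub, Matrix.trace_smul, Matrix.trace_one]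
  simp only [smul_eq_mul]
  field_simp
  ring

/-- The coefficient of the innovation `(r, i, j)` in the Hermitization of `(√n)⁻¹ X`, where `X` is
the data matrix. -/
noncomputable def innovationCoeff {K p n : ℕ} (A : Fin K → Matrix (Fin p) (Fin p) ℂ)
    (B : Fin K → Matrix (Fin n) (Fin n) ℂ) (q : Fin K × Fin p × Fin n) :
    Matrix (Fin p ⊕ Fin n) (Fin p ⊕ Fin n) ℂ :=
  Matrix.fromRows (((√n)⁻¹ : ℂ) • CFC.sqrt (A q.1)) 0 * Matrix.single q.2.1 q.2.2 (1 : ℂ) *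
    Matrix.fromCols 0 (CFC.sqrt (B q.1))

/-- The innovation matrices with entries `x (r, i, j)`. -/
def innovationMatrix {K p n : ℕ} (x : Fin K × Fin p × Fin n → ℂ) (r : Fin K) :
    Matrix (Fin p) (Fin n) ℂ :=
  Matrix.of fun i j => x (r, i, j)

variable {K p n : ℕ} (A : Fin K → Matrix (Fin p) (Fin p) ℂ)
  (B : Fin K → Matrix (Fin n) (Fin n) ℂ) (x : Fin K × Fin p × Fin n → ℂ)

theorem dataMatrix_innovationMatrix : dataMatrix A B (innovationMatrix x) =
    ∑ q, x q • (CFC.sqrt (A q.1) * Matrix.single q.2.1 q.2.2 (1 : ℂ) * CFC.sqrt (B q.1)) := by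
  have hentries (r : Fin K) : innovationMatrix x r =
      ∑ i, ∑ j, x (r, i, j) • Matrix.single i j (1 : ℂ) := by
    conv_lhs => rw [Matrix.matrix_eq_sum_single (innovationMatrix x r)]
    simp [innovationMatrix]
  simp only [dataMatrix, Fintype.sum_prod_type, hentries, Matrix.mul_sum, Matrix.sum_mul,
    Matrix.mul_smul, Matrix.smul_mul]

theorem innovationCoeff_eq_fromBlocks (q : Fin K × Fin p × Fin n) :
    innovationCoeff A B q = Matrix.fromBlocks 0 (((√n)⁻¹ : ℂ) •
      (CFC.sqrt (A q.1) * Matrix.single q.2.1 q.2.2 (1 : ℂ) * CFC.sqrt (B q.1))) 0 0 := by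
  rw [innovationCoeff, Matrix.fromRows_mul, Matrix.fromRows_mul_fromCols]
  simp

theorem hermPencil_innovationCoeff : hermPencil (innovationCoeff A B) x =
    Matrix.fromBlocks 0 (((√n)⁻¹ : ℂ) • dataMatrix A B (innovationMatrix x))
      (((√n)⁻¹ : ℂ) • dataMatrix A B (innovationMatrix x))ᴴ 0 := by
  have hcomb : Fintype.linearCombination ℂ (innovationCoeff A B) x = Matrix.fromBlocks 0
      (((√n)⁻¹ : ℂ) • dataMatrix A B (innovationMatrix x)) 0 0 := by
    simp only [Fintype.linearCombination_apply, innovationCoeff_eq_fromBlocks,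
      dataMatrix_innovationMatrix, Finset.smul_sum]
    ext (i | i) (j | j) <;> simp [Matrix.sum_apply, mul_left_comm]
  rw [hermPencil, addAdjoint, hcomb, Matrix.fromBlocks_conjTranspose, Matrix.fromBlocks_add]
  simp

theorem sampleCov_eq_mul_conjTranspose (Z : Fin K → Matrix (Fin p) (Fin n) ℂ) :
    sampleCov A B Z =
      (((√n)⁻¹ : ℂ) • dataMatrix A B Z) * (((√n)⁻¹ : ℂ) • dataMatrix A B Z)ᴴ := by
  have hsqrt : ((√n : ℝ) : ℂ) * (√n : ℝ) = n := by
    rw [← Complex.ofReal_mul, Real.mul_self_sqrt (Nat.cast_nonneg n), Complex.ofReal_natCast]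
  rw [sampleCov, Matrix.conjTranspose_smul, Matrix.smul_mul, Matrix.mul_smul, smul_smul,
    star_inv₀, Complex.star_def, Complex.conj_ofReal, ← mul_inv, hsqrt, one_div]

theorem mem_resolventSet_sampleCov (Z : Fin K → Matrix (Fin p) (Fin n) ℂ) {z : ℂ}
    (hz : z.im ≠ 0) : z ∈ resolventSet ℂ (sampleCov A B Z) := by
  rw [sampleCov_eq_mul_conjTranspose]
  exact mem_resolventSet_of_im_ne_zero (Matrix.isHermitian_mul_conjTranspose_self _) hz

theorem stieltjes_eq_trace_resolvent {S : Matrix (Fin p) (Fin p) ℂ} {z : ℂ}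
    (hz : z ∈ resolventSet ℂ S) : stieltjes S z = -(p : ℂ)⁻¹ * (resolvent S z).trace := by
  have hinv : (S - z • 1)⁻¹ = -resolvent S z := by
    refine Matrix.inv_eq_right_inv ?_
    rw [mul_neg, ← neg_mul, neg_sub, ← Algebra.algebraMap_eq_smul_one]
    exact Ring.mul_inverse_cancel _ hz
  rw [stieltjes, hinv, Matrix.trace_neg, one_div, mul_neg, neg_mul]

theorem stieltjes_sampleCov_sq_eq {w : ℂ} (hw : (w ^ 2).im ≠ 0) :
    stieltjes (sampleCov A B (innovationMatrix x)) (w ^ 2) = -(2 * w * p)⁻¹ *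
      (resolvent (hermPencil (innovationCoeff A B) x) w).trace +
        (2 * w * p)⁻¹ * ((n - p) / w) := by
  have hw₀ : w ≠ 0 := by
    rintro rfl
    simp at hw
  have hmem := mem_resolventSet_sampleCov A B (innovationMatrix x) hw
  rw [stieltjes_eq_trace_resolvent hmem]
  rw [sampleCov_eq_mul_conjTranspose] at hmem ⊢
  rw [hermPencil_innovationCoeff, trace_resolvent_fromBlocks _ _ hw₀ hmem, Fintype.card_fin,
    Fintype.card_fin]
  field_simp
  ring

theorem im_ne_zero_of_sq {w : ℂ} (hw : (w ^ 2).im ≠ 0) : w.im ≠ 0 := by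
  intro h
  simp [sq, h] at hw

theorem continuous_stieltjes_sampleCov {z : ℂ} (hz : z.im ≠ 0) : Continuous
    fun x : Fin K × Fin p × Fin n → ℂ => stieltjes (sampleCov A B (innovationMatrix x)) z := by
  obtain ⟨w, rfl⟩ := IsAlgClosed.exists_pow_nat_eq z two_pos
  simp only [stieltjes_sampleCov_sq_eq A B _ hz]
  exact ((continuous_resolvent_hermPencil _ (im_ne_zero_of_sq hz)).matrix_trace.const_mul _).add
    continuous_const

omit [DecidableEq k] in
theorem norm_eq_of_conjTranspose_mul_self_eq {k' : Type*} [Fintype k'] {M : Matrix k l ℂ}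
    {N : Matrix k' l ℂ} (h : Mᴴ * M = Nᴴ * N) : ‖M‖ = ‖N‖ := by
  have hnorm := congrArg norm h
  rw [Matrix.l2_opNorm_conjTranspose_mul_self, Matrix.l2_opNorm_conjTranspose_mul_self] at hnorm
  exact (mul_self_inj (norm_nonneg M) (norm_nonneg N)).1 hnorm

omit [DecidableEq k] in
theorem norm_fromRows_zero {k' : Type*} [Fintype k'] (M : Matrix k l ℂ) :
    ‖(Matrix.fromRows M 0 : Matrix (k ⊕ k') l ℂ)‖ = ‖M‖ :=
  norm_eq_of_conjTranspose_mul_self_eq <| by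
    rw [Matrix.conjTranspose_fromRows_eq_fromCols_conjTranspose, Matrix.fromCols_mul_fromRows,
      Matrix.mul_zero, add_zero]

omit [DecidableEq k] in
theorem norm_fromCols_zero {l' : Type*} [Fintype l'] [DecidableEq l'] (M : Matrix k l ℂ) :
    ‖(Matrix.fromCols 0 M : Matrix k (l' ⊕ l) ℂ)‖ = ‖M‖ := by
  classical
  rw [← Matrix.l2_opNorm_conjTranspose, ← Matrix.l2_opNorm_conjTranspose M]
  refine norm_eq_of_conjTranspose_mul_self_eq ?_
  rw [Matrix.conjTranspose_conjTranspose, Matrix.conjTranspose_conjTranspose,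
    Matrix.conjTranspose_fromCols_eq_fromRows_conjTranspose, Matrix.fromCols_mul_fromRows,
    Matrix.zero_mul, zero_add]

variable {τ : ℝ}

theorem norm_sqrt_le {m : ℕ} {S : Matrix (Fin m) (Fin m) ℂ} (hS : S.PosSemidef)
    (hSτ : opNorm S ≤ τ) : ‖CFC.sqrt S‖ ≤ √τ := by
  have hsq := Matrix.l2_opNorm_conjTranspose_mul_self (CFC.sqrt S)
  rw [← Matrix.star_eq_conjTranspose, (CFC.sqrt_nonneg S).isSelfAdjoint,
    CFC.sqrt_mul_sqrt_self S hS.nonneg] at hsq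
  refine Real.le_sqrt_of_sq_le ?_
  rwa [sq, ← hsq]

variable {A B}

theorem norm_smul_sqrt_mul_norm_sqrt_le {r : Fin K} (hA : (A r).PosSemidef) (hB : (B r).PosSemidef)
    (hAτ : opNorm (A r) ≤ τ) (hBτ : opNorm (B r) ≤ τ) :
    ‖((√n)⁻¹ : ℂ) • CFC.sqrt (A r)‖ * ‖CFC.sqrt (B r)‖ ≤ τ / √n := by
  have hτ : 0 ≤ τ := (norm_nonneg _).trans hAτ
  have hnorm : ‖((√n)⁻¹ : ℂ)‖ = (√n)⁻¹ := by
    rw [norm_inv, Complex.norm_real, Real.norm_of_nonneg (Real.sqrt_nonneg _)]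
  calc ‖((√n)⁻¹ : ℂ) • CFC.sqrt (A r)‖ * ‖CFC.sqrt (B r)‖ ≤ (√n)⁻¹ * √τ * √τ := by
        rw [norm_smul, hnorm]
        gcongr
        exacts [norm_sqrt_le hA hAτ, norm_sqrt_le hB hBτ]
    _ = τ / √n := by rw [mul_assoc, Real.mul_self_sqrt hτ, mul_comm, div_eq_mul_inv]

variable (hA : ∀ r, (A r).PosSemidef) (hB : ∀ r, (B r).PosSemidef)
  (hAτ : ∀ r, opNorm (A r) ≤ τ) (hBτ : ∀ r, opNorm (B r) ≤ τ)

include hA hB hAτ hBτ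

theorem traceNormLE_innovationCoeff (q : Fin K × Fin p × Fin n) :
    TraceNormLE (innovationCoeff A B q) (τ / √n) := by
  refine (traceNormLE_mul_single_mul _ _ _ _).mono ?_
  rw [norm_fromRows_zero, norm_fromCols_zero]
  exact norm_smul_sqrt_mul_norm_sqrt_le (hA _) (hB _) (hAτ _) (hBτ _)

theorem sum_unmatchedTerm_innovationCoeff_le {G : Matrix (Fin p ⊕ Fin n) (Fin p ⊕ Fin n) ℂ}
    {η : ℝ} (hG : ‖G‖ ≤ η) :
    ∑ q, unmatchedTerm G (innovationCoeff A B q) ≤ K * ((p + n) * ((τ / √n) ^ 2 * η ^ 3)) := by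
  have hr (r : Fin K) : ∑ i, ∑ j, unmatchedTerm G (innovationCoeff A B (r, i, j)) ≤
      (p + n) * ((τ / √n) ^ 2 * η ^ 3) := by
    have h := sum_unmatchedTerm_mul_single_mul_le (G := G)
      (Matrix.fromRows (((√n)⁻¹ : ℂ) • CFC.sqrt (A r)) 0) (Matrix.fromCols 0 (CFC.sqrt (B r)))
    rw [norm_fromRows_zero, norm_fromCols_zero, Fintype.card_fin, Fintype.card_fin] at h
    refine h.trans ?_
    gcongr
    exact norm_smul_sqrt_mul_norm_sqrt_le (hA r) (hB r) (hAτ r) (hBτ r)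
  simp only [Fintype.sum_prod_type]
  exact (Finset.sum_le_sum fun r _ => hr r).trans_eq (by simp)

theorem norm_integral_stieltjes_sampleCov_sq_sub_le {w : ℂ} (hw : (w ^ 2).im ≠ 0)
    {μ ν : Fin K × Fin p × Fin n → Measure ℂ}
    [∀ q, IsProbabilityMeasure (μ q)] [∀ q, IsProbabilityMeasure (ν q)] {ε₁ ε₂ L : ℝ}
    (hμ : ∀ q, IsNearStandard (μ q) ε₁ ε₂ L) (hν : ∀ q, IsNearStandard (ν q) ε₁ ε₂ L) :
    ‖∫ x, stieltjes (sampleCov A B (innovationMatrix x)) (w ^ 2) ∂Measure.pi μ -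
      ∫ x, stieltjes (sampleCov A B (innovationMatrix x)) (w ^ 2) ∂Measure.pi ν‖ ≤
      (2 * ‖w‖ * p)⁻¹ * (2 * (1 + ε₂) *
        (K * ((p + n) * ((τ / √n) ^ 2 * |w.im|⁻¹ ^ 3)) * harmonic (K * (p * n))) +
        K * (p * n) * lindebergError ε₁ ε₂ L (2 * (τ / √n) * |w.im|⁻¹ ^ 2)
          (2 * (τ / √n) ^ 2 * |w.im|⁻¹ ^ 3) (12 * (τ / √n) ^ 3 * |w.im|⁻¹ ^ 4)) := by
  have hw' := im_ne_zero_of_sq hw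
  have hbound := norm_integral_trace_resolvent_hermPencil_sub_le (innovationCoeff A B) hμ hν
    (traceNormLE_innovationCoeff hA hB hAτ hBτ) hw'
    fun G hG => sum_unmatchedTerm_innovationCoeff_le hA hB hAτ hBτ hG
  have hint (ρ : Fin K × Fin p × Fin n → Measure ℂ) [∀ q, IsProbabilityMeasure (ρ q)] :
      ∫ x, stieltjes (sampleCov A B (innovationMatrix x)) (w ^ 2) ∂Measure.pi ρ =
        -(2 * w * p)⁻¹ * ∫ x, (resolvent (hermPencil (innovationCoeff A B) x) w).trace
          ∂Measure.pi ρ + (2 * w * p)⁻¹ * ((n - p) / w) := by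
    simp only [stieltjes_sampleCov_sq_eq A B _ hw]
    rw [integral_add ((integrable_trace_resolvent_hermPencil _ hw' _).const_mul _)
      (integrable_const _), integral_const_mul, integral_const, probReal_univ, one_smul]
  have hnorm : ‖-(2 * w * p)⁻¹‖ = (2 * ‖w‖ * p)⁻¹ := by simp
  rw [hint μ, hint ν, add_sub_add_right_eq_sub, ← mul_sub, norm_mul, hnorm]
  simp only [Fintype.card_prod, Fintype.card_fin, Nat.cast_mul] at hbound
  gcongr

end Hermitization

section StandardLaws

/-- A centred complex law with second absolute moment `1`. -/
structure IsStandardLaw (μ : Measure ℂ) : Prop where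
  isProbabilityMeasure : IsProbabilityMeasure μ
  mean_eq_zero : ∫ h, h ∂μ = 0
  secondMoment_eq_one : ∫ h, ‖h‖ ^ 2 ∂μ = 1

/-- The scalar version of `truncate`. -/
noncomputable def truncAt (b : ℝ) (h : ℂ) : ℂ :=
  if ‖h‖ ≤ b then h else 0

theorem measurable_truncAt (b : ℝ) : Measurable (truncAt b) :=
  Measurable.ite (measurableSet_le measurable_norm measurable_const) measurable_id measurable_const

theorem norm_truncAt_le_norm (b : ℝ) (h : ℂ) : ‖truncAt b h‖ ≤ ‖h‖ := by
  unfold truncAt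
  split_ifs <;> simp

theorem norm_truncAt_le {b : ℝ} (hb : 0 ≤ b) (h : ℂ) : ‖truncAt b h‖ ≤ b := by
  unfold truncAt
  split_ifs with hh
  · exact hh
  · simpa using hb

variable {E : Type*} [NormedAddCommGroup E] {f : ℂ → E} {b s t M : ℝ}

theorem norm_comp_truncAt_sub_le (hf₀ : f 0 = 0) (hf : ∀ h, ‖f h‖ ≤ ‖h‖ ^ s) (hst : s ≤ t)
    (hb : 0 < b) (h : ℂ) : ‖f (truncAt b h) - f h‖ ≤ b ^ (s - t) * ‖h‖ ^ t := by
  unfold truncAt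
  split_ifs with hh
  · rw [sub_self, norm_zero]
    positivity
  · have hlt := lt_of_not_ge hh
    rw [hf₀, zero_sub, norm_neg]
    calc ‖f h‖ ≤ ‖h‖ ^ s := hf h
      _ = ‖h‖ ^ (s - t) * ‖h‖ ^ t := by rw [← Real.rpow_add (hb.trans hlt), sub_add_cancel]
      _ ≤ b ^ (s - t) * ‖h‖ ^ t := mul_le_mul_of_nonneg_right
          (Real.rpow_le_rpow_of_nonpos hb hlt.le (sub_nonpos.2 hst)) (by positivity)

variable {μ : Measure ℂ}

theorem norm_integral_map_truncAt_sub_le [NormedSpace ℝ E] (hfμ : Integrable f μ)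
    (hfc : Continuous f) (hf₀ : f 0 = 0) (hf : ∀ h, ‖f h‖ ≤ ‖h‖ ^ s) (hst : s ≤ t) (hb : 0 < b)
    (ht : Integrable (fun h : ℂ => ‖h‖ ^ t) μ) (hM : ∫ h : ℂ, ‖h‖ ^ t ∂μ ≤ M) :
    ‖∫ h, f h ∂μ.map (truncAt b) - ∫ h, f h ∂μ‖ ≤ M * b ^ (s - t) := by
  have hm := measurable_truncAt b
  have hle := norm_comp_truncAt_sub_le hf₀ hf hst hb
  have hsub : Integrable (fun h => f (truncAt b h) - f h) μ :=
    (ht.const_mul _).mono' (by fun_prop) (ae_of_all _ hle)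
  rw [integral_map hm.aemeasurable hfc.aestronglyMeasurable,
    ← integral_sub ((hsub.add hfμ).congr (ae_of_all _ fun h => sub_add_cancel _ _)) hfμ]
  calc ‖∫ h, f (truncAt b h) - f h ∂μ‖ ≤ ∫ h, b ^ (s - t) * ‖h‖ ^ t ∂μ :=
        norm_integral_le_of_norm_le (ht.const_mul _) (ae_of_all _ hle)
    _ = (∫ h, ‖h‖ ^ t ∂μ) * b ^ (s - t) := by rw [integral_const_mul, mul_comm]
    _ ≤ M * b ^ (s - t) := mul_le_mul_of_nonneg_right hM (by positivity)

namespace IsStandardLaw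

theorem memLp_two (hμ : IsStandardLaw μ) : MemLp id 2 μ := by
  refine (memLp_two_iff_integrable_sq_norm (by fun_prop)).2 (not_imp_comm.1 integral_undef ?_)
  simp [hμ.secondMoment_eq_one]

theorem integrable_norm_sq (hμ : IsStandardLaw μ) : Integrable (fun h : ℂ => ‖h‖ ^ 2) μ :=
  hμ.memLp_two.integrable_norm_pow two_ne_zero

theorem isNearStandard (hμ : IsStandardLaw μ) (h₃ : MemLp id 3 μ) :
    IsNearStandard μ 0 0 (∫ h, ‖h‖ ^ 3 ∂μ) :=
  ⟨h₃, by simp [hμ.mean_eq_zero], by simp [hμ.secondMoment_eq_one], le_rfl⟩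

theorem thirdMoment_map_le (hμ : IsStandardLaw μ) {g : ℂ → ℂ} (hg : Measurable g)
    (hgb : ∀ᵐ h ∂μ, ‖g h‖ ≤ b) (hgn : ∀ h, ‖g h‖ ≤ ‖h‖) :
    ∫ h, ‖h‖ ^ 3 ∂μ.map g ≤ b := by
  have hle : ∀ᵐ h ∂μ, ‖g h‖ ^ 3 ≤ b * ‖h‖ ^ 2 := hgb.mono fun h hh => by
    rw [pow_succ']
    exact mul_le_mul hh (pow_le_pow_left₀ (norm_nonneg _) (hgn h) 2) (by positivity)
      ((norm_nonneg _).trans hh)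
  rw [integral_map hg.aemeasurable (by fun_prop)]
  calc ∫ h, ‖g h‖ ^ 3 ∂μ ≤ ∫ h, b * ‖h‖ ^ 2 ∂μ := integral_mono_of_nonneg
        (ae_of_all _ fun h => by positivity) (hμ.integrable_norm_sq.const_mul b) hle
    _ = b := by rw [integral_const_mul, hμ.secondMoment_eq_one, mul_one]

theorem isNearStandard_of_ae_norm_le (hμ : IsStandardLaw μ) (hb : ∀ᵐ h ∂μ, ‖h‖ ≤ b) :
    IsNearStandard μ 0 0 b := by
  have := hμ.isProbabilityMeasure
  have hthird := hμ.thirdMoment_map_le measurable_id hb fun _ => le_rfl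
  rw [Measure.map_id] at hthird
  exact (hμ.isNearStandard (.of_bound (by fun_prop) b hb)).mono le_rfl le_rfl hthird

theorem isNearStandard_map_truncAt (hμ : IsStandardLaw μ) (ht : 2 ≤ t) (hb : 0 < b)
    (hi : Integrable (fun h : ℂ => ‖h‖ ^ t) μ) (hM : ∫ h : ℂ, ‖h‖ ^ t ∂μ ≤ M) :
    IsNearStandard (μ.map (truncAt b)) (M * b ^ (1 - t)) (M * b ^ (2 - t)) b := by
  have := hμ.isProbabilityMeasure
  have hm := measurable_truncAt b
  have hbd := norm_truncAt_le hb.le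
  have hint : Integrable (fun h : ℂ => h) μ := hμ.memLp_two.integrable one_le_two
  refine ⟨?_, ?_, ?_, hμ.thirdMoment_map_le hm (ae_of_all _ hbd) (norm_truncAt_le_norm b)⟩
  · rw [memLp_map_measure_iff (by fun_prop) hm.aemeasurable]
    exact .of_bound hm.aestronglyMeasurable b (ae_of_all _ hbd)
  · have hmean := norm_integral_map_truncAt_sub_le hint continuous_id rfl
      (fun h => (Real.rpow_one _).ge) (one_le_two.trans ht) hb hi hM
    simpa [hμ.mean_eq_zero] using hmean
  · have hvar := norm_integral_map_truncAt_sub_le (f := fun h : ℂ => ‖h‖ ^ 2)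
      hμ.integrable_norm_sq (by fun_prop) (by simp) (s := 2) (by simp) ht hb hi hM
    rwa [hμ.secondMoment_eq_one, Real.norm_eq_abs] at hvar

end IsStandardLaw

end StandardLaws

section Gaussian

theorem hasLaw_stdComplexGaussian :
    HasLaw (fun x : ℝ × ℝ => (x.1 : ℂ) + (x.2 : ℂ) * Complex.I) stdComplexGaussian
      ((gaussianReal 0 (1 / 2)).prod (gaussianReal 0 (1 / 2))) :=
  ⟨by fun_prop, rfl⟩

theorem memLp_stdComplexGaussian {q : ENNReal} (hq : q ≠ ⊤) : MemLp id q stdComplexGaussian := by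
  have hre : MemLp (fun x : ℝ => (x : ℂ)) q (gaussianReal 0 (1 / 2)) :=
    (memLp_id_gaussianReal' q hq).ofReal
  have him : MemLp (fun x : ℝ => (x : ℂ) * Complex.I) q (gaussianReal 0 (1 / 2)) :=
    hre.mul_const _
  rw [stdComplexGaussian, memLp_map_measure_iff (by fun_prop) (by fun_prop)]
  exact (hre.comp_fst _).add (him.comp_snd _)

theorem integrable_norm_rpow_stdComplexGaussian {t : ℝ} (ht : 0 < t) :
    Integrable (fun h : ℂ => ‖h‖ ^ t) stdComplexGaussian := by
  simpa [ENNReal.toReal_ofReal ht.le] using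
    (memLp_stdComplexGaussian (q := ENNReal.ofReal t) (by simp)).integrable_norm_rpow
      (by simpa using ht) (by simp)

theorem isStandardLaw_stdComplexGaussian : IsStandardLaw stdComplexGaussian := by
  have hlaw := hasLaw_stdComplexGaussian
  have hid : Integrable (fun x : ℝ => x) (gaussianReal 0 (1 / 2)) :=
    (memLp_id_gaussianReal 1).integrable (by norm_num)
  have hsq : Integrable (fun x : ℝ => x ^ 2) (gaussianReal 0 (1 / 2)) :=
    (memLp_id_gaussianReal 2).integrable_sq
  have hvar : ∫ x : ℝ, x ^ 2 ∂gaussianReal 0 (1 / 2) = 1 / 2 := by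
    simpa using (variance_of_integral_eq_zero (μ := gaussianReal 0 (1 / 2)) (X := id)
      aemeasurable_id (by simp)).symm
  refine ⟨hlaw.isProbabilityMeasure_iff.1 inferInstance, ?_, ?_⟩
  · rw [← hlaw.integral_comp (f := fun h => h) (by fun_prop)]
    have hre : Integrable (fun x : ℝ × ℝ => (x.1 : ℂ))
        ((gaussianReal 0 (1 / 2)).prod (gaussianReal 0 (1 / 2))) := hid.ofReal.comp_fst _
    have him : Integrable (fun x : ℝ × ℝ => (x.2 : ℂ) * Complex.I)
        ((gaussianReal 0 (1 / 2)).prod (gaussianReal 0 (1 / 2))) :=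
      (hid.ofReal.comp_snd (gaussianReal 0 (1 / 2))).mul_const Complex.I
    simp only [Function.comp_def]
    rw [integral_add hre him, integral_mul_const, integral_complex_ofReal, integral_complex_ofReal,
      integral_fun_fst (fun x : ℝ => x), integral_fun_snd (fun x : ℝ => x)]
    simp
  · rw [← hlaw.integral_comp (f := fun h => ‖h‖ ^ 2) (by fun_prop)]
    have hnorm (x : ℝ × ℝ) : ‖(x.1 : ℂ) + (x.2 : ℂ) * Complex.I‖ ^ 2 = x.1 ^ 2 + x.2 ^ 2 := by
      rw [Complex.norm_add_mul_I, Real.sq_sqrt (by positivity)]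
    simp only [Function.comp_def, hnorm]
    rw [integral_add (hsq.comp_fst _) (hsq.comp_snd _), integral_fun_fst (fun x : ℝ => x ^ 2),
      integral_fun_snd (fun x : ℝ => x ^ 2), hvar]
    norm_num

end Gaussian

section AsymptoticallyStandard

/-- An array of complex laws whose `n`-th row is standard up to errors that are negligible for
matrices with `n` columns: `o(1 / √n)` in the means and `o(1)` in the second absolute moments, with
third absolute moments of size `o(√n)`, uniformly over the row. -/
def IsAsymptoticallyStandard {ι : ℕ → Type*} (μ : ∀ n, ι n → Measure ℂ) : Prop :=
  ∃ ε₁ ε₂ L : ℕ → ℝ, Tendsto (fun n : ℕ => √n * ε₁ n) atTop (𝓝 0) ∧ Tendsto ε₂ atTop (𝓝 0) ∧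
    Tendsto (fun n : ℕ => L n / √n) atTop (𝓝 0) ∧
    ∀ᶠ n in atTop, ∀ q, IsNearStandard (μ n q) (ε₁ n) (ε₂ n) (L n)

theorem tendsto_natCast_rpow_zero {s : ℝ} (hs : s < 0) :
    Tendsto (fun n : ℕ => (n : ℝ) ^ s) atTop (𝓝 0) := by
  simpa [Function.comp_def] using
    (tendsto_rpow_neg_atTop (neg_pos.2 hs)).comp (tendsto_natCast_atTop_atTop (R := ℝ))

theorem tendsto_natCast_rpow_div_sqrt {a : ℝ} (ha : a < 1 / 2) :
    Tendsto (fun n : ℕ => (n : ℝ) ^ a / √n) atTop (𝓝 0) := by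
  refine (tendsto_natCast_rpow_zero (sub_neg.2 ha)).congr' ?_
  filter_upwards [eventually_gt_atTop 0] with n hn
  rw [Real.rpow_sub (by exact_mod_cast hn), Real.sqrt_eq_rpow]

theorem tendsto_sqrt_mul_natCast_rpow {s : ℝ} (hs : s < -(1 / 2)) (M : ℝ) :
    Tendsto (fun n : ℕ => √(n : ℝ) * (M * (n : ℝ) ^ s)) atTop (𝓝 0) := by
  have hlim := (tendsto_natCast_rpow_zero (s := 1 / 2 + s) (by linarith)).const_mul M
  rw [mul_zero] at hlim
  refine hlim.congr' ?_
  filter_upwards [eventually_gt_atTop 0] with n hn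
  rw [Real.rpow_add (by exact_mod_cast hn), Real.sqrt_eq_rpow, mul_left_comm]

variable {ι : ℕ → Type*} {μ ν : ∀ n, ι n → Measure ℂ} {a t M : ℝ}

theorem isAsymptoticallyStandard_const {ρ : Measure ℂ} (hρ : IsStandardLaw ρ)
    (h₃ : MemLp id 3 ρ) : IsAsymptoticallyStandard fun n (_ : ι n) => ρ :=
  ⟨0, 0, fun _ => ∫ h, ‖h‖ ^ 3 ∂ρ, by simp, tendsto_const_nhds,
    (Real.tendsto_sqrt_atTop.comp tendsto_natCast_atTop_atTop).const_div_atTop _,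
    Eventually.of_forall fun _ _ => hρ.isNearStandard h₃⟩

theorem isAsymptoticallyStandard_of_ae_norm_le (hμ : ∀ n q, IsStandardLaw (μ n q))
    (ha : a < 1 / 2) (hb : ∀ (n : ℕ) q, ∀ᵐ h ∂μ n q, ‖h‖ ≤ (n : ℝ) ^ a) :
    IsAsymptoticallyStandard μ :=
  ⟨0, 0, fun n => (n : ℝ) ^ a, by simp, tendsto_const_nhds, tendsto_natCast_rpow_div_sqrt ha,
    Eventually.of_forall fun n q => (hμ n q).isNearStandard_of_ae_norm_le (hb n q)⟩

theorem isAsymptoticallyStandard_map_truncAt (hμ : ∀ n q, IsStandardLaw (μ n q)) (ht : 2 < t)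
    (ha : 1 / (2 * (t - 1)) < a) (ha' : a < 1 / 2)
    (hM : ∀ n q, Integrable (fun h : ℂ => ‖h‖ ^ t) (μ n q) ∧ ∫ h : ℂ, ‖h‖ ^ t ∂μ n q ≤ M) :
    IsAsymptoticallyStandard fun n q => (μ n q).map (truncAt ((n : ℝ) ^ a)) := by
  have ha₀ : 0 < a := lt_trans (by have := sub_pos.2 (one_lt_two.trans ht); positivity) ha
  rw [div_lt_iff₀ (by linarith)] at ha
  have hmean := tendsto_sqrt_mul_natCast_rpow (s := a * (1 - t)) (by linarith) M
  have hvar := (tendsto_natCast_rpow_zero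
    (mul_neg_of_pos_of_neg ha₀ (sub_neg.2 ht))).const_mul M
  rw [mul_zero] at hvar
  simp only [Real.rpow_mul (Nat.cast_nonneg _)] at hmean hvar
  refine ⟨_, _, _, hmean, hvar, tendsto_natCast_rpow_div_sqrt ha', ?_⟩
  filter_upwards [eventually_gt_atTop 0] with n hn q
  exact (hμ n q).isNearStandard_map_truncAt ht.le (Real.rpow_pos_of_pos (by exact_mod_cast hn) a)
    (hM n q).1 (hM n q).2

theorem IsAsymptoticallyStandard.exists_common (hμ : IsAsymptoticallyStandard μ)
    (hν : IsAsymptoticallyStandard ν) :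
    ∃ ε₁ ε₂ L : ℕ → ℝ, Tendsto (fun n : ℕ => √n * ε₁ n) atTop (𝓝 0) ∧ Tendsto ε₂ atTop (𝓝 0) ∧
      Tendsto (fun n : ℕ => L n / √n) atTop (𝓝 0) ∧
      ∀ᶠ n in atTop, (∀ q, IsNearStandard (μ n q) (ε₁ n) (ε₂ n) (L n)) ∧
        ∀ q, IsNearStandard (ν n q) (ε₁ n) (ε₂ n) (L n) := by
  obtain ⟨ε₁, ε₂, L, h₁, h₂, hL, hμ⟩ := hμ
  obtain ⟨δ₁, δ₂, R, h₁', h₂', hR, hν⟩ := hν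
  refine ⟨fun n => max (ε₁ n) (δ₁ n), fun n => max (ε₂ n) (δ₂ n), fun n => max (L n) (R n),
    ?_, ?_, ?_, ?_⟩
  · simpa [mul_max_of_nonneg] using h₁.max h₁'
  · simpa using h₂.max h₂'
  · simpa [max_div_div_right] using hL.max hR
  · filter_upwards [hμ, hν] with n hμn hνn
    exact ⟨fun q => (hμn q).mono (le_max_left _ _) (le_max_left _ _) (le_max_left _ _),
      fun q => (hνn q).mono (le_max_right _ _) (le_max_right _ _) (le_max_right _ _)⟩

end AsymptoticallyStandard

section IndependentEntries

/-- The entries `V r ω i j` of all the random matrices `V r` are independent, with laws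
`μ (r, i, j)`. -/
structure HasIndepEntries {Ω : Type*} [MeasurableSpace Ω] {K p n : ℕ}
    (V : Fin K → Ω → Matrix (Fin p) (Fin n) ℂ) (μ : Fin K × Fin p × Fin n → Measure ℂ)
    (P : Measure Ω) : Prop where
  hasLaw : ∀ q, HasLaw (fun ω => V q.1 ω q.2.1 q.2.2) (μ q) P
  indep : iIndepFun (fun (q : Fin K × Fin p × Fin n) ω => V q.1 ω q.2.1 q.2.2) P

namespace HasIndepEntries

variable {Ω : Type*} [MeasurableSpace Ω] {P : Measure Ω} {K p n : ℕ}
  {V : Fin K → Ω → Matrix (Fin p) (Fin n) ℂ} {μ : Fin K × Fin p × Fin n → Measure ℂ}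

theorem isProbabilityMeasure (hV : HasIndepEntries V μ P) (q : Fin K × Fin p × Fin n) :
    IsProbabilityMeasure (μ q) :=
  (hV.hasLaw q).isProbabilityMeasure_iff.1 hV.indep.isProbabilityMeasure

protected theorem truncate (hV : HasIndepEntries V μ P) (b : ℝ) :
    HasIndepEntries (fun r ω => truncate b (V r ω)) (fun q => (μ q).map (truncAt b)) P :=
  ⟨fun q => HasLaw.fun_comp ⟨(measurable_truncAt b).aemeasurable, rfl⟩ (hV.hasLaw q),
    hV.indep.comp (fun _ => truncAt b) fun _ => measurable_truncAt b⟩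

theorem integral_stieltjes_sampleCov (hV : HasIndepEntries V μ P)
    (A : Fin K → Matrix (Fin p) (Fin p) ℂ) (B : Fin K → Matrix (Fin n) (Fin n) ℂ) {z : ℂ}
    (hz : z.im ≠ 0) :
    ∫ ω, stieltjes (sampleCov A B fun r => V r ω) z ∂P =
      ∫ x, stieltjes (sampleCov A B (innovationMatrix x)) z ∂Measure.pi μ := by
  have := hV.indep.isProbabilityMeasure
  have := hV.isProbabilityMeasure
  exact (hV.indep.hasLaw_pi hV.hasLaw).integral_comp
    (continuous_stieltjes_sampleCov A B hz).aestronglyMeasurable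

end HasIndepEntries

end IndependentEntries

section Asymptotics

open Asymptotics

theorem isLittleO_log_natCast_mul {α : Type*} {l : Filter α} {a b : α → ℕ} {g : α → ℝ}
    (ha : (fun x => Real.log (a x)) =o[l] g) (hb : (fun x => Real.log (b x)) =o[l] g) :
    (fun x => Real.log ((a x * b x : ℕ) : ℝ)) =o[l] g := by
  refine IsBigO.trans_isLittleO (.of_norm_le fun x => ?_) (ha.norm_left.add hb.norm_left)
  rcases eq_or_ne (a x) 0 with ha₀ | ha₀
  · simp [ha₀]
  rcases eq_or_ne (b x) 0 with hb₀ | hb₀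
  · simp [hb₀]
  rw [Nat.cast_mul, Real.log_mul (by exact_mod_cast ha₀) (by exact_mod_cast hb₀)]
  exact norm_add_le _ _

theorem isLittleO_harmonic {α : Type*} {l : Filter α} {N : α → ℕ} {g : α → ℝ}
    (h₁ : (fun _ => (1 : ℝ)) =o[l] g) (hlog : (fun x => Real.log (N x)) =o[l] g) :
    (fun x => (harmonic (N x) : ℝ)) =o[l] g := by
  refine IsBigO.trans_isLittleO (.of_norm_le fun x => ?_) (h₁.add hlog)
  have hnonneg : (0 : ℝ) ≤ harmonic (N x) :=
    Rat.cast_nonneg.2 (Finset.sum_nonneg fun i _ => by positivity)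
  rw [Real.norm_of_nonneg hnonneg]
  exact harmonic_le_one_add_log _

theorem tendsto_natCast_mul_lindebergError {ε₁ ε₂ L : ℕ → ℝ} (C₁ C₂ C₃ : ℝ)
    (h₁ : Tendsto (fun n : ℕ => √n * ε₁ n) atTop (𝓝 0)) (h₂ : Tendsto ε₂ atTop (𝓝 0))
    (hL : Tendsto (fun n : ℕ => L n / √n) atTop (𝓝 0)) :
    Tendsto (fun n : ℕ => n * lindebergError (ε₁ n) (ε₂ n) (L n)
      (C₁ / √n) (C₂ / √n ^ 2) (C₃ / √n ^ 3)) atTop (𝓝 0) := by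
  have hs : Tendsto (fun n : ℕ => C₃ / √n) atTop (𝓝 0) :=
    (Real.tendsto_sqrt_atTop.comp tendsto_natCast_atTop_atTop).const_div_atTop _
  have hlim := ((((h₁.mul_const C₁).add (h₂.mul_const C₂)).add
    (((h₂.const_add 1).pow 2).mul hs)).add (hL.const_mul C₃)).const_mul 2
  simp only [zero_mul, mul_zero, add_zero] at hlim
  refine hlim.congr' ?_
  filter_upwards [eventually_gt_atTop 0] with n hn
  have hn₀ : (√n : ℝ) ≠ 0 := by positivity
  rw [lindebergError, ← Real.sq_sqrt (Nat.cast_nonneg n), Real.sqrt_sq (Real.sqrt_nonneg _)]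
  field_simp

theorem isLittleO_harmonic_mul {α : Type*} {l : Filter α} {a b : α → ℕ} (K : ℕ)
    (hb : Tendsto b l atTop) (hlog : (fun x => Real.log (a x)) =o[l] fun x => (b x : ℝ)) :
    (fun x => (harmonic (K * (a x * b x)) : ℝ)) =o[l] fun x => (b x : ℝ) := by
  have hb' := (tendsto_natCast_atTop_atTop (R := ℝ)).comp hb
  have hconst (c : ℝ) : (fun _ => c) =o[l] fun x => (b x : ℝ) :=
    isLittleO_const_left.2 (.inr (tendsto_norm_atTop_atTop.comp hb'))
  exact isLittleO_harmonic (hconst 1) (isLittleO_log_natCast_mul (hconst _)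
    (isLittleO_log_natCast_mul hlog (Real.isLittleO_log_id_atTop.comp_tendsto hb')))

theorem tendsto_atTop_of_isLittleO_log {α : Type*} {l : Filter α} {a b : α → ℕ}
    (hb : Tendsto b l atTop) (hlog : (fun x => Real.log (b x)) =o[l] fun x => (a x : ℝ)) :
    Tendsto a l atTop := by
  have hlogb := Real.tendsto_log_atTop.comp (tendsto_natCast_atTop_atTop.comp hb)
  have hnorm := hlog.isBigO.trans_tendsto_norm_atTop (tendsto_norm_atTop_atTop.comp hlogb)
  simpa only [Real.norm_natCast, tendsto_natCast_atTop_iff] using hnorm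

variable {p : ℕ → ℕ}

theorem tendsto_replacementBound {ε₁ ε₂ L : ℕ → ℝ} (K : ℕ) (τ s η : ℝ)
    (hlogp : (fun n => Real.log (p n)) =o[atTop] fun n => (n : ℝ))
    (hlogn : (fun n : ℕ => Real.log n) =o[atTop] fun n => (p n : ℝ))
    (h₁ : Tendsto (fun n : ℕ => √n * ε₁ n) atTop (𝓝 0)) (h₂ : Tendsto ε₂ atTop (𝓝 0))
    (hL : Tendsto (fun n : ℕ => L n / √n) atTop (𝓝 0)) :
    Tendsto (fun n : ℕ => (2 * s * p n)⁻¹ * (2 * (1 + ε₂ n) *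
      (K * ((p n + n) * ((τ / √n) ^ 2 * η ^ 3)) * harmonic (K * (p n * n))) +
      K * (p n * n) * lindebergError (ε₁ n) (ε₂ n) (L n) (2 * (τ / √n) * η ^ 2)
        (2 * (τ / √n) ^ 2 * η ^ 3) (12 * (τ / √n) ^ 3 * η ^ 4))) atTop (𝓝 0) := by
  have hn : Tendsto (fun n : ℕ => n) atTop atTop := tendsto_id
  have hp := tendsto_atTop_of_isLittleO_log hn hlogn
  have hHn := isLittleO_harmonic_mul K hn hlogp
  have hHp := isLittleO_harmonic_mul K hp hlogn
  simp only [mul_comm _ (p _)] at hHp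
  have hunmatched := ((h₂.const_add 1).mul (hHn.tendsto_div_nhds_zero.add
    hHp.tendsto_div_nhds_zero)).const_mul (s⁻¹ * K * τ ^ 2 * η ^ 3)
  have herror := (tendsto_natCast_mul_lindebergError (2 * τ * η ^ 2) (2 * τ ^ 2 * η ^ 3)
    (12 * τ ^ 3 * η ^ 4) h₁ h₂ hL).const_mul (K / (2 * s))
  have hlim := hunmatched.add herror
  simp only [add_zero, mul_zero] at hlim
  refine hlim.congr' ?_
  filter_upwards [hp.eventually_gt_atTop 0, eventually_gt_atTop 0] with n hpn hn
  have hsqrt : (τ / √n) ^ 2 = τ ^ 2 / n := by rw [div_pow, Real.sq_sqrt n.cast_nonneg]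
  have hC₁ : 2 * (τ / √n) * η ^ 2 = 2 * τ * η ^ 2 / √n := by ring
  have hC₂ : 2 * (τ / √n) ^ 2 * η ^ 3 = 2 * τ ^ 2 * η ^ 3 / √n ^ 2 := by ring
  have hC₃ : 12 * (τ / √n) ^ 3 * η ^ 4 = 12 * τ ^ 3 * η ^ 4 / √n ^ 3 := by ring
  rw [hC₁, hC₂, hC₃, hsqrt]
  field_simp

variable {Ω Ω' : Type*} [MeasurableSpace Ω] [MeasurableSpace Ω'] {P : Measure Ω} {P' : Measure Ω'}
  {K : ℕ} {A : (n : ℕ) → Fin K → Matrix (Fin (p n)) (Fin (p n)) ℂ}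
  {B : (n : ℕ) → Fin K → Matrix (Fin n) (Fin n) ℂ} {τ : ℝ} {z : ℂ}
  {V : (n : ℕ) → Fin K → Ω → Matrix (Fin (p n)) (Fin n) ℂ}
  {V' : (n : ℕ) → Fin K → Ω' → Matrix (Fin (p n)) (Fin n) ℂ}
  {μ ν : (n : ℕ) → Fin K × Fin (p n) × Fin n → Measure ℂ}

theorem tendsto_norm_integral_stieltjes_sub
    (hlogp : (fun n => Real.log (p n)) =o[atTop] fun n => (n : ℝ))
    (hlogn : (fun n : ℕ => Real.log n) =o[atTop] fun n => (p n : ℝ))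
    (hA : ∀ n r, (A n r).PosSemidef) (hB : ∀ n r, (B n r).PosSemidef)
    (hAτ : ∀ n r, opNorm (A n r) ≤ τ) (hBτ : ∀ n r, opNorm (B n r) ≤ τ) (hz : z.im ≠ 0)
    (hV : ∀ n, HasIndepEntries (V n) (μ n) P) (hV' : ∀ n, HasIndepEntries (V' n) (ν n) P')
    (hμ : IsAsymptoticallyStandard μ) (hν : IsAsymptoticallyStandard ν) :
    Tendsto (fun n : ℕ => ‖(∫ ω, stieltjes (sampleCov (A n) (B n) fun r => V n r ω) z ∂P) -
      ∫ ω, stieltjes (sampleCov (A n) (B n) fun r => V' n r ω) z ∂P'‖) atTop (𝓝 0) := by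
  obtain ⟨w, rfl⟩ := IsAlgClosed.exists_pow_nat_eq z two_pos
  obtain ⟨ε₁, ε₂, L, h₁, h₂, hL, hnear⟩ := hμ.exists_common hν
  refine squeeze_zero' (.of_forall fun n => norm_nonneg _) ?_
    (tendsto_replacementBound K τ ‖w‖ |w.im|⁻¹ hlogp hlogn h₁ h₂ hL)
  filter_upwards [hnear] with n hn
  have := (hV n).isProbabilityMeasure
  have := (hV' n).isProbabilityMeasure
  rw [(hV n).integral_stieltjes_sampleCov _ _ hz, (hV' n).integral_stieltjes_sampleCov _ _ hz]
  exact norm_integral_stieltjes_sampleCov_sq_sub_le (hA n) (hB n) (hAτ n) (hBτ n) hz hn.1 hn.2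

end Asymptotics

section Conclusion

open Asymptotics

theorem isLittleO_log_of_tendsto_div {α : Type*} {l : Filter α} {f g : α → ℝ} {c : ℝ} (hc : c ≠ 0)
    (hfg : Tendsto (fun x => f x / g x) l (𝓝 c)) (hg : Tendsto g l atTop) (hf : ∀ x, 0 ≤ f x) :
    (fun x => Real.log (f x)) =o[l] g ∧ (fun x => Real.log (g x)) =o[l] f := by
  have htheta : f =Θ[l] g := (isTheta_of_div_tendsto_nhds_ne_zero hfg hc).symm
  have hf' : Tendsto f l atTop := by
    simpa [Function.comp_def, abs_of_nonneg, hf] using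
      htheta.tendsto_norm_atTop_iff.2 (tendsto_norm_atTop_atTop.comp hg)
  exact ⟨(Real.isLittleO_log_id_atTop.comp_tendsto hf').trans_isTheta htheta,
    (Real.isLittleO_log_id_atTop.comp_tendsto hg).trans_isTheta htheta.symm⟩

variable {Ω Ω' : Type*} [MeasurableSpace Ω] [MeasurableSpace Ω']

theorem isStandardLaw_map {P : Measure Ω} [IsProbabilityMeasure P] {X : Ω → ℂ}
    (hX : AEMeasurable X P) (hmean : ∫ ω, X ω ∂P = 0) (hvar : ∫ ω, ‖X ω‖ ^ 2 ∂P = 1) :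
    IsStandardLaw (P.map X) :=
  ⟨Measure.isProbabilityMeasure_map hX, by rwa [integral_map hX (by fun_prop)],
    by rwa [integral_map hX (by fun_prop)]⟩

theorem theorem4p8_general (P : Measure Ω) (P' : Measure Ω') (K : ℕ) (p : ℕ → ℕ)
    (hlogp : (fun n => Real.log (p n)) =o[atTop] fun n => (n : ℝ))
    (hlogn : (fun n : ℕ => Real.log n) =o[atTop] fun n => (p n : ℝ))
    (A : (n : ℕ) → Fin K → Matrix (Fin (p n)) (Fin (p n)) ℂ)
    (B : (n : ℕ) → Fin K → Matrix (Fin n) (Fin n) ℂ)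
    (hA : ∀ n r, (A n r).PosSemidef) (hB : ∀ n r, (B n r).PosSemidef)
    (τ : ℝ) (hAτ : ∀ n r, opNorm (A n r) ≤ τ) (hBτ : ∀ n r, opNorm (B n r) ≤ τ)
    (Z : (n : ℕ) → Fin K → Ω → Matrix (Fin (p n)) (Fin n) ℂ)
    (hZmeas : ∀ n r i j, AEMeasurable (fun ω => Z n r ω i j) P)
    (hZindep : ∀ n, iIndepFun
      (fun (q : Fin K × Fin (p n) × Fin n) (ω : Ω) => Z n q.1 ω q.2.1 q.2.2) P)
    (hZmean : ∀ n r i j, ∫ ω, Z n r ω i j ∂P = 0)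
    (hZvar : ∀ n r i j, ∫ ω, ‖Z n r ω i j‖ ^ 2 ∂P = 1)
    (W : (n : ℕ) → Fin K → Ω' → Matrix (Fin (p n)) (Fin n) ℂ)
    (hWlaw : ∀ n r i j, HasLaw (fun ω => W n r ω i j) stdComplexGaussian P')
    (hWindep : ∀ n, iIndepFun
      (fun (q : Fin K × Fin (p n) × Fin n) (ω : Ω') => W n q.1 ω q.2.1 q.2.2) P')
    (t a : ℝ) (ht : 2 < t) (ha : 1 / (2 * (t - 1)) < a) (ha' : a < 1 / 2)
    (z : ℂ) (hz : z.im ≠ 0) :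
    ((∃ M : ℝ, ∀ n r i j, Integrable (fun ω => ‖Z n r ω i j‖ ^ t) P ∧
        ∫ ω, ‖Z n r ω i j‖ ^ t ∂P ≤ M) →
      Tendsto (fun n : ℕ =>
        ‖(∫ ω, stieltjes (sampleCov (A n) (B n)
            fun r => truncate ((n : ℝ) ^ a) (W n r ω)) z ∂P') -
          ∫ ω, stieltjes (sampleCov (A n) (B n)
            fun r => truncate ((n : ℝ) ^ a) (Z n r ω)) z ∂P‖) atTop (𝓝 0) ∧
      Tendsto (fun n : ℕ =>
        ‖(∫ ω, stieltjes (sampleCov (A n) (B n) fun r => W n r ω) z ∂P') -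
          ∫ ω, stieltjes (sampleCov (A n) (B n)
            fun r => truncate ((n : ℝ) ^ a) (Z n r ω)) z ∂P‖) atTop (𝓝 0)) ∧
    ((∀ n r i j, ∀ᵐ ω ∂P, ‖Z n r ω i j‖ ≤ (n : ℝ) ^ a) →
      Tendsto (fun n : ℕ =>
        ‖(∫ ω, stieltjes (sampleCov (A n) (B n)
            fun r => truncate ((n : ℝ) ^ a) (W n r ω)) z ∂P') -
          ∫ ω, stieltjes (sampleCov (A n) (B n) fun r => Z n r ω) z ∂P‖) atTop (𝓝 0) ∧
      Tendsto (fun n : ℕ =>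
        ‖(∫ ω, stieltjes (sampleCov (A n) (B n) fun r => W n r ω) z ∂P') -
          ∫ ω, stieltjes (sampleCov (A n) (B n) fun r => Z n r ω) z ∂P‖) atTop (𝓝 0)) := by
  have := (hZindep 0).isProbabilityMeasure
  have hmeas n (q : Fin K × Fin (p n) × Fin n) := hZmeas n q.1 q.2.1 q.2.2
  have hZ n : HasIndepEntries (Z n) (fun q => P.map fun ω => Z n q.1 ω q.2.1 q.2.2) P :=
    ⟨fun q => ⟨hmeas n q, rfl⟩, hZindep n⟩
  have hW n : HasIndepEntries (W n) (fun _ => stdComplexGaussian) P' :=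
    ⟨fun q => hWlaw n q.1 q.2.1 q.2.2, hWindep n⟩
  have hZstd n (q : Fin K × Fin (p n) × Fin n) := isStandardLaw_map (hmeas n q)
    (hZmean n q.1 q.2.1 q.2.2) (hZvar n q.1 q.2.1 q.2.2)
  have hGauss := isStandardLaw_stdComplexGaussian
  have hW₀ : IsAsymptoticallyStandard fun n (_ : Fin K × Fin (p n) × Fin n) =>
      stdComplexGaussian :=
    isAsymptoticallyStandard_const hGauss (memLp_stdComplexGaussian (by simp))
  have hWtr : IsAsymptoticallyStandard fun n (_ : Fin K × Fin (p n) × Fin n) =>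
      stdComplexGaussian.map (truncAt ((n : ℝ) ^ a)) :=
    isAsymptoticallyStandard_map_truncAt (fun _ _ => hGauss) ht ha ha' fun _ _ =>
      ⟨integrable_norm_rpow_stdComplexGaussian (two_pos.trans ht), le_rfl⟩
  have hWT n := (hW n).truncate ((n : ℝ) ^ a)
  constructor
  · rintro ⟨M, hM⟩
    have hpow : Measurable fun h : ℂ => ‖h‖ ^ t := measurable_norm.pow_const t
    have hZtr := isAsymptoticallyStandard_map_truncAt hZstd ht ha ha' (M := M) fun n q => by
      rw [integrable_map_measure hpow.aestronglyMeasurable (hmeas n q),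
        integral_map (hmeas n q) hpow.aestronglyMeasurable]
      exact hM n q.1 q.2.1 q.2.2
    have hZT n := (hZ n).truncate ((n : ℝ) ^ a)
    exact ⟨tendsto_norm_integral_stieltjes_sub hlogp hlogn hA hB hAτ hBτ hz hWT hZT hWtr hZtr,
      tendsto_norm_integral_stieltjes_sub hlogp hlogn hA hB hAτ hBτ hz hW hZT hW₀ hZtr⟩
  · intro hb
    have hZ₀ := isAsymptoticallyStandard_of_ae_norm_le hZstd ha' fun n q =>
      (ae_map_iff (hmeas n q) (measurableSet_le measurable_norm measurable_const)).2
        (hb n q.1 q.2.1 q.2.2)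
    exact ⟨tendsto_norm_integral_stieltjes_sub hlogp hlogn hA hB hAτ hBτ hz hWT hZ hWtr hZ₀,
      tendsto_norm_integral_stieltjes_sub hlogp hlogn hA hB hAτ hBτ hz hW hZ hW₀ hZ₀⟩

end Conclusion

theorem theorem4p8
    {Ω Ω' : Type*} [MeasurableSpace Ω] [MeasurableSpace Ω']
    (P : Measure Ω) [IsProbabilityMeasure P] (P' : Measure Ω') [IsProbabilityMeasure P']
    (K : ℕ) (p : ℕ → ℕ) (c : ℝ) (hc : 0 < c)
    (hp : Tendsto (fun n : ℕ => (p n : ℝ) / (n : ℝ)) atTop (𝓝 c))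
    -- scaling matrices: positive semidefinite, uniformly bounded in operator norm
    (A : (n : ℕ) → Fin K → Matrix (Fin (p n)) (Fin (p n)) ℂ)
    (B : (n : ℕ) → Fin K → Matrix (Fin n) (Fin n) ℂ)
    (hA : ∀ n r, (A n r).PosSemidef) (hB : ∀ n r, (B n r).PosSemidef)
    (τ : ℝ) (hτ : 0 < τ)
    (hAτ : ∀ n r, opNorm (A n r) ≤ τ) (hBτ : ∀ n r, opNorm (B n r) ≤ τ)
    -- innovations: for each `n`, independent entries, mean zero, unit variance
    (Z : (n : ℕ) → Fin K → Ω → Matrix (Fin (p n)) (Fin n) ℂ)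
    (hZmeas : ∀ n r i j, Measurable fun ω => Z n r ω i j)
    (hZindep : ∀ n, iIndepFun
      (fun (q : Fin K × Fin (p n) × Fin n) (ω : Ω) => Z n q.1 ω q.2.1 q.2.2) P)
    (hZmean : ∀ n r i j, ∫ ω, Z n r ω i j ∂P = 0)
    (hZvar : ∀ n r i j, ∫ ω, ‖Z n r ω i j‖ ^ 2 ∂P = 1)
    -- Gaussian innovations: for each `n`, i.i.d. standard complex Gaussian entries
    (W : (n : ℕ) → Fin K → Ω' → Matrix (Fin (p n)) (Fin n) ℂ)
    (hWlaw : ∀ n r i j, HasLaw (fun ω => W n r ω i j) stdComplexGaussian P')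
    (hWindep : ∀ n, iIndepFun
      (fun (q : Fin K × Fin (p n) × Fin n) (ω : Ω') => W n q.1 ω q.2.1 q.2.2) P')
    -- truncation exponent
    (η₀ a : ℝ) (hη₀ : 0 < η₀) (ha : 1 / (4 + η₀) < a) (ha' : a < 1 / 4)
    (z : ℂ) (hz : 0 < z.im) :
    -- entries with uniformly bounded moments of order `4 + η₀`, truncated at `n ^ a`
    ((∃ M : ℝ, ∀ n r i j, Integrable (fun ω => ‖Z n r ω i j‖ ^ (4 + η₀)) P ∧
        ∫ ω, ‖Z n r ω i j‖ ^ (4 + η₀) ∂P ≤ M) →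
      Tendsto (fun n : ℕ =>
        ‖(∫ ω, stieltjes (sampleCov (A n) (B n)
            fun r => truncate ((n : ℝ) ^ a) (W n r ω)) z ∂P') -
          ∫ ω, stieltjes (sampleCov (A n) (B n)
            fun r => truncate ((n : ℝ) ^ a) (Z n r ω)) z ∂P‖) atTop (𝓝 0) ∧
      Tendsto (fun n : ℕ =>
        ‖(∫ ω, stieltjes (sampleCov (A n) (B n) fun r => W n r ω) z ∂P') -
          ∫ ω, stieltjes (sampleCov (A n) (B n)
            fun r => truncate ((n : ℝ) ^ a) (Z n r ω)) z ∂P‖) atTop (𝓝 0)) ∧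
    -- standardized entries that are themselves bounded by `n ^ a`
    ((∀ n r i j, ∀ᵐ ω ∂P, ‖Z n r ω i j‖ ≤ (n : ℝ) ^ a) →
      Tendsto (fun n : ℕ =>
        ‖(∫ ω, stieltjes (sampleCov (A n) (B n)
            fun r => truncate ((n : ℝ) ^ a) (W n r ω)) z ∂P') -
          ∫ ω, stieltjes (sampleCov (A n) (B n) fun r => Z n r ω) z ∂P‖) atTop (𝓝 0) ∧
      Tendsto (fun n : ℕ =>
        ‖(∫ ω, stieltjes (sampleCov (A n) (B n) fun r => W n r ω) z ∂P') -
          ∫ ω, stieltjes (sampleCov (A n) (B n) fun r => Z n r ω) z ∂P‖) atTop (𝓝 0)) := by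
  obtain ⟨hlogp, hlogn⟩ := isLittleO_log_of_tendsto_div hc.ne' hp tendsto_natCast_atTop_atTop
    fun n => (p n).cast_nonneg
  have ha'' : 1 / (2 * (4 + η₀ - 1)) < a :=
    (one_div_le_one_div_of_le (by linarith) (by linarith)).trans_lt ha
  exact theorem4p8_general P P' K p hlogp hlogn A B hA hB τ hAτ hBτ Z
    (fun n r i j => (hZmeas n r i j).aemeasurable) hZindep hZmean hZvar W hWlaw hWindep (4 + η₀) a
    (by linarith) ha'' (by linarith) z hz.ne'
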